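/- Let $\mathbb K=\mathbb R$ or $\mathbb C$, let $1\le q\le n$ and let $x_1,\dots,x_n$ be the coordinates of $\mathbb K^n$. Let $\mathcal O$ be one of the following rings of functions: germs at the origin of smooth functions on $\mathbb K^n$; germs at the origin of analytic functions on $\mathbb K^n$; formal power series in $x_1,\dots,x_n$ over $\mathbb K$; smooth functions on all of $\mathbb K^n$; analytic functions on all of $\mathbb K^n$ (derivatives are taken over $\mathbb K$, so for $\mathbb K=\mathbb C$ smooth means holomorphic). All vector fields, multivector fields and differential forms have coefficients in $\mathcal O$. Let $\Omega=u\,dx_1\wedge\dots\wedge dx_n$, with $u\in\mathcal O$ invertible, be a volume form, and let $p=n-q$. A $p$-form $\omega$ is integrable if $\omega\wedge i_A\omega=0$ and $d\omega\wedge i_A\omega=0$ for every $(p-1)$-vector field $A$ (no condition if $p=0$). A $p$-form $\eta$ is an infinitesimal deformation of an integrable $p$-form $\omega$ if $\omega+\varepsilon\eta$ is integrable modulo $\varepsilon^2$, that is, if for every $(p-1)$-vector field $A$ $$\omega\wedge i_A\eta+\eta\wedge i_A\omega=0\quad\text{and}\quad d\omega\wedge i_A\eta+d\eta\wedge i_A\omega=0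 .$$ A $q$-vector field $\Lambda$ is a Nambu structure if $i_\Lambda\Omega$ is integrable. In that case $\mathcal Z(\Lambda)$ denotes the space of its infinitesimal deformations, i.e. of the $q$-vector fields $\Pi$ such that $i_\Pi\Omega$ is an infinitesimal deformation of $i_\Lambda\Omega$; $\mathcal B(\Lambda)$ denotes the space of its trivial deformations $\mathcal L_X\Lambda$, with $X$ a vector field; and the deformation cohomology of $\Lambda$ is $DH(\Lambda)=\mathcal Z(\Lambda)/\mathcal B(\Lambda)$. Then $\Lambda=\dfrac{\partial}{\partial x_1}\wedge\dots\wedge\dfrac{\partial}{\partial x_q}$ is a Nambu structure, $\mathcal B(\Lambda)\subseteq\mathcal Z(\Lambda)$, and $DH(\Lambda)=\{0\}$; that is, every infinitesimal deformation of $\Lambda$ is of the form $\mathcal L_X\Lambda$ for some vector field $X$. -/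

import Mathlib

open scoped Topology

noncomputable section

namespace NambuDeformation

/-! ### Rings of functions with partial derivatives -/

/-- The two kinds of convergent functions: smooth and analytic. Derivatives are taken over the base
field `𝕜`, so that over `ℂ` both are the holomorphic functions. -/
inductive Regularity where
  | smooth : Regularity
  | analytic : Regularity

open scoped ContDiff in
/-- Smooth is `C^∞`, analytic is `C^ω`. -/
def Regularity.order : Regularity → WithTop ℕ∞
  | .smooth => ∞
  | .analytic => ω

section Functions

variable (𝕜 : Type*) [RCLike 𝕜] (n : ℕ) (r : Regularity) (S : Set (Fin n → 𝕜))

/-- Functions on `𝕜ⁿ` that are smooth (analytic) on a neighbourhood of `S`. -/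
def regularFunctions : Subalgebra 𝕜 ((Fin n → 𝕜) → 𝕜) where
  carrier := {f | ∀ᶠ x in 𝓝ˢ S, ContDiffAt 𝕜 r.order f x}
  mul_mem' {f g} hf hg := by
    have hf' : ∀ᶠ x in 𝓝ˢ S, ContDiffAt 𝕜 r.order f x := hf
    have hg' : ∀ᶠ x in 𝓝ˢ S, ContDiffAt 𝕜 r.order g x := hg
    exact (hf'.and hg').mono fun x h => h.1.mul h.2
  add_mem' {f g} hf hg := by
    have hf' : ∀ᶠ x in 𝓝ˢ S, ContDiffAt 𝕜 r.order f x := hf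
    have hg' : ∀ᶠ x in 𝓝ˢ S, ContDiffAt 𝕜 r.order g x := hg
    exact (hf'.and hg').mono fun x h => h.1.add h.2
  algebraMap_mem' c := by
    have h : ∀ᶠ x in 𝓝ˢ S, ContDiffAt 𝕜 r.order (fun _ : Fin n → 𝕜 => c) x :=
      Filter.Eventually.of_forall fun _ => contDiffAt_const
    exact h

/-- The functions that vanish on a neighbourhood of `S`. -/
def vanishingFunctions : Ideal (regularFunctions 𝕜 n r S) where
  carrier := {f | ∀ᶠ x in 𝓝ˢ S, (f : (Fin n → 𝕜) → 𝕜) x = 0}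
  add_mem' {f g} hf hg := by
    have hf' : ∀ᶠ x in 𝓝ˢ S, (f : (Fin n → 𝕜) → 𝕜) x = 0 := hf
    have hg' : ∀ᶠ x in 𝓝ˢ S, (g : (Fin n → 𝕜) → 𝕜) x = 0 := hg
    exact (hf'.and hg').mono fun x h => by simp [h.1, h.2]
  zero_mem' := by
    have h : ∀ᶠ x in 𝓝ˢ S, ((0 : regularFunctions 𝕜 n r S) : (Fin n → 𝕜) → 𝕜) x = 0 :=
      Filter.Eventually.of_forall fun _ => rfl
    exact h
  smul_mem' c f hf := by
    have hf' : ∀ᶠ x in 𝓝ˢ S, (f : (Fin n → 𝕜) → 𝕜) x = 0 := hf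
    exact hf'.mono fun x h => by simp [h]

/-- The ring of germs along `S` of smooth (analytic) functions on `𝕜ⁿ`. For `S = {0}` these are the
germs at the origin; for `S = Set.univ` these are the smooth (analytic) functions on `𝕜ⁿ`. -/
def Germs : Type _ := regularFunctions 𝕜 n r S ⧸ vanishingFunctions 𝕜 n r S

instance : CommRing (Germs 𝕜 n r S) :=
  inferInstanceAs (CommRing (regularFunctions 𝕜 n r S ⧸ vanishingFunctions 𝕜 n r S))

instance : Algebra 𝕜 (Germs 𝕜 n r S) :=
  inferInstanceAs (Algebra 𝕜 (regularFunctions 𝕜 n r S ⧸ vanishingFunctions 𝕜 n r S))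

/-- The germ of a function. -/
def toGerm : regularFunctions 𝕜 n r S →ₐ[𝕜] Germs 𝕜 n r S :=
  Ideal.Quotient.mkₐ 𝕜 (vanishingFunctions 𝕜 n r S)

lemma toGerm_surjective : Function.Surjective (toGerm 𝕜 n r S) :=
  Ideal.Quotient.mkₐ_surjective 𝕜 (vanishingFunctions 𝕜 n r S)

variable {𝕜 n r S} in
lemma toGerm_eq {f g : regularFunctions 𝕜 n r S} :
    toGerm 𝕜 n r S f = toGerm 𝕜 n r S g ↔
      ∀ᶠ x in 𝓝ˢ S, (f : (Fin n → 𝕜) → 𝕜) x = (g : (Fin n → 𝕜) → 𝕜) x := by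
  refine (Ideal.Quotient.eq (I := vanishingFunctions 𝕜 n r S)).trans ?_
  change (∀ᶠ x in 𝓝ˢ S, ((f - g : regularFunctions 𝕜 n r S) : (Fin n → 𝕜) → 𝕜) x = 0) ↔ _
  refine Filter.eventually_congr (Filter.Eventually.of_forall fun x => ?_)
  exact sub_eq_zero

/-- The partial derivative `∂f/∂x_i`. -/
def partialFun (i : Fin n) (f : regularFunctions 𝕜 n r S) : regularFunctions 𝕜 n r S :=
  ⟨fun x => fderiv 𝕜 (f : (Fin n → 𝕜) → 𝕜) x (Pi.single i 1), by
    have hf : ∀ᶠ x in 𝓝ˢ S, ContDiffAt 𝕜 r.order (f : (Fin n → 𝕜) → 𝕜) x := f.2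
    have h1 : r.order + 1 ≤ r.order := by cases r <;> exact le_rfl
    have h2 : ∀ᶠ x in 𝓝ˢ S, ContDiffAt 𝕜 r.order
        (fun x => fderiv 𝕜 (f : (Fin n → 𝕜) → 𝕜) x (Pi.single i 1)) x :=
      hf.mono fun x hx => (hx.fderiv_right h1).clm_apply contDiffAt_const
    exact h2⟩

variable {𝕜 n r S} in
lemma differentiableAt_regularFunctions (f : regularFunctions 𝕜 n r S) :
    ∀ᶠ x in 𝓝ˢ S, DifferentiableAt 𝕜 (f : (Fin n → 𝕜) → 𝕜) x := by
  have hf : ∀ᶠ x in 𝓝ˢ S, ContDiffAt 𝕜 r.order (f : (Fin n → 𝕜) → 𝕜) x := f.2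
  filter_upwards [hf] with x hx
  exact hx.differentiableAt (by cases r <;> simp [Regularity.order])

variable {𝕜 n r S} in
lemma partialFun_congr (i : Fin n) {f g : regularFunctions 𝕜 n r S}
    (h : toGerm 𝕜 n r S f = toGerm 𝕜 n r S g) :
    toGerm 𝕜 n r S (partialFun 𝕜 n r S i f) = toGerm 𝕜 n r S (partialFun 𝕜 n r S i g) := by
  obtain ⟨U, hU, hSU, h0⟩ := eventually_nhdsSet_iff_exists.1 (toGerm_eq.1 h)
  refine toGerm_eq.2 (eventually_nhdsSet_iff_exists.2 ⟨U, hU, hSU, fun x hx => ?_⟩)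
  have h1 : (f : (Fin n → 𝕜) → 𝕜) =ᶠ[𝓝 x] g := by
    filter_upwards [hU.mem_nhds hx] with y hy using h0 y hy
  simp [partialFun, h1.fderiv_eq]

/-- The partial derivative of a germ is the germ of the partial derivative. -/
def germPartialFun (i : Fin n) (a : Germs 𝕜 n r S) : Germs 𝕜 n r S :=
  toGerm 𝕜 n r S (partialFun 𝕜 n r S i (toGerm_surjective 𝕜 n r S a).choose)

lemma germPartialFun_toGerm (i : Fin n) (f : regularFunctions 𝕜 n r S) :
    germPartialFun 𝕜 n r S i (toGerm 𝕜 n r S f) = toGerm 𝕜 n r S (partialFun 𝕜 n r S i f) :=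
  partialFun_congr i (toGerm_surjective 𝕜 n r S (toGerm 𝕜 n r S f)).choose_spec

/-- The partial derivative `∂/∂x_i` on germs, as a derivation. -/
def germPartial (i : Fin n) : Derivation 𝕜 (Germs 𝕜 n r S) (Germs 𝕜 n r S) :=
  Derivation.mk'
    { toFun := germPartialFun 𝕜 n r S i
      map_add' := fun a b => by
        obtain ⟨f, rfl⟩ := toGerm_surjective 𝕜 n r S a
        obtain ⟨g, rfl⟩ := toGerm_surjective 𝕜 n r S b
        rw [← map_add]
        simp only [germPartialFun_toGerm]
        rw [← map_add, toGerm_eq]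
        filter_upwards [differentiableAt_regularFunctions f,
          differentiableAt_regularFunctions g] with x hf hg
        simp [partialFun, fderiv_add hf hg]
      map_smul' := fun c a => by
        obtain ⟨f, rfl⟩ := toGerm_surjective 𝕜 n r S a
        rw [← map_smul]
        simp only [germPartialFun_toGerm, RingHom.id_apply]
        rw [← map_smul, toGerm_eq]
        filter_upwards [differentiableAt_regularFunctions f] with x hf
        simp [partialFun, fderiv_const_smul hf] }
    fun a b => by
      obtain ⟨f, rfl⟩ := toGerm_surjective 𝕜 n r S a
      obtain ⟨g, rfl⟩ := toGerm_surjective 𝕜 n r S b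
      simp only [LinearMap.coe_mk, AddHom.coe_mk, smul_eq_mul]
      rw [← map_mul]
      simp only [germPartialFun_toGerm]
      rw [← map_mul, ← map_mul, ← map_add, toGerm_eq]
      filter_upwards [differentiableAt_regularFunctions f,
        differentiableAt_regularFunctions g] with x hf hg
      simp [partialFun, fderiv_mul hf hg]

end Functions

/-! ### Multivector fields and differential forms over a ring `O` of functions on `𝕜ⁿ`

`O` is one of the rings of functions (smooth, analytic, formal) on `𝕜ⁿ` and `D i` stands for the
partial derivative `∂/∂x_i` of functions. -/

section Tensors

variable {𝕜 : Type*} [Field 𝕜] {O : Type*} [CommRing O] [Algebra 𝕜 O] {n : ℕ}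

variable (O n) in
/-- The vector field `∑ X_i ∂/∂x_i` is given by its components `X_i`. -/
abbrev VField : Type _ := Fin n → O

variable (O n) in
/-- All multivector fields; those of degree `q` are the elements of `⋀[O]^q (VField O n)`. -/
abbrev MultiVec : Type _ := ExteriorAlgebra O (VField O n)

variable (O n) in
/-- All differential forms; those of degree `p` are the elements of
`⋀[O]^p (Module.Dual O (VField O n))`. -/
abbrev DForm : Type _ := ExteriorAlgebra O (Module.Dual O (VField O n))

variable (O) in
/-- The `1`-form `dx_i`. -/
def dx (i : Fin n) : Module.Dual O (VField O n) := LinearMap.proj (φ := fun _ : Fin n => O) i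

variable (O n) in
/-- The basis of multivector fields formed by the `∂/∂x_{i_1} ∧ … ∧ ∂/∂x_{i_k}`, `i_1 < … < i_k`. -/
def multiVecBasis : Module.Basis (Finset (Fin n)) O (MultiVec O n) :=
  (Pi.basisFun O (Fin n)).ExteriorAlgebra

variable (O n) in
/-- The basis of differential forms formed by the `dx_{i_1} ∧ … ∧ dx_{i_k}`, `i_1 < … < i_k`. -/
def formBasis : Module.Basis (Finset (Fin n)) O (DForm O n) :=
  (Pi.basisFun O (Fin n)).dualBasis.ExteriorAlgebra

/-- Apply the derivation `δ` to each coefficient in the basis `b`. -/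
def coeffDeriv {M : Type*} [AddCommGroup M] [Module O M] [Module 𝕜 M] [IsScalarTower 𝕜 O M]
    (b : Module.Basis (Finset (Fin n)) O M) (δ : Derivation 𝕜 O O) : M →ₗ[𝕜] M where
  toFun m := ∑ I, δ (b.repr m I) • b I
  map_add' m m' := by simp [add_smul, Finset.sum_add_distrib]
  map_smul' c m := by
    have h : ∀ I, b.repr (c • m) I = c • b.repr m I := fun I => by
      rw [← algebraMap_smul O c m, map_smul, Finsupp.smul_apply, algebraMap_smul]
    simp [h, Finset.smul_sum]

/-- The exterior derivative, `d(f dx_I) = ∑ i, ∂f/∂x_i dx_i ∧ dx_I`. -/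
def extDer (D : Fin n → Derivation 𝕜 O O) (ω : DForm O n) : DForm O n :=
  ∑ i, ExteriorAlgebra.ι O (dx O i) * coeffDeriv (formBasis O n) (D i) ω

/-- Contraction of a multivector field with the `1`-form `α`: the antiderivation
`i_α (X ∧ A) = α(X) A - X ∧ i_α A`. -/
def contractForm (α : Module.Dual O (VField O n)) : MultiVec O n →ₗ[O] MultiVec O n :=
  CliffordAlgebra.contractLeft α

variable (O n) in
/-- Contraction `i_A ω` of a form `ω` with a multivector field `A`. For a vector field `X`, `i_X` is
the antiderivation with `i_X (α ∧ ω) = α(X) ω - α ∧ i_X ω`, and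
`i_{X_1 ∧ … ∧ X_k} = i_{X_1} ∘ … ∘ i_{X_k}`. (The opposite order of composition changes `i_A` by a
sign that depends only on the degree `k`, which is immaterial below.) -/
def contractMulti : MultiVec O n →ₐ[O] Module.End O (DForm O n) :=
  ExteriorAlgebra.lift O
    ⟨(CliffordAlgebra.contractLeft (Q := (0 : QuadraticForm O (Module.Dual O (VField O n))))) ∘ₗ
      Module.Dual.eval O (VField O n), fun X => by
        refine LinearMap.ext fun ω => ?_
        exact CliffordAlgebra.contractLeft_contractLeft (Q := 0) _ ω⟩

/-- The Lie derivative `L_X Π` of a multivector field along the vector field `X`: `L_X` differentiates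
the coefficients of `Π` along `X`, and acts on the basis vectors by
`L_X (∂/∂x_i) = [X, ∂/∂x_i] = - ∑ k, ∂X_k/∂x_i ∂/∂x_k`, extended as a derivation of the
wedge product. -/
def lieDeriv (D : Fin n → Derivation 𝕜 O O) (X : VField O n) (P : MultiVec O n) : MultiVec O n :=
  ∑ i, (X i • coeffDeriv (multiVecBasis O n) (D i) P -
    ExteriorAlgebra.ι O (fun k => D i (X k)) * contractForm (dx O i) P)

/-- A volume form is an `n`-form `u dx_1 ∧ … ∧ dx_n` with `u` an invertible function. -/
def IsVolumeForm (Ω : DForm O n) : Prop :=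
  ∃ u : Oˣ, Ω = (u : O) • ExteriorAlgebra.ιMulti O n (dx O)

/-- Integrable `p`-forms: `ω ∧ i_A ω = 0` and `dω ∧ i_A ω = 0` for each `(p-1)`-vector field `A`. -/
def IsIntegrable (D : Fin n → Derivation 𝕜 O O) (p : ℕ) (ω : DForm O n) : Prop :=
  ω ∈ ⋀[O]^p (Module.Dual O (VField O n)) ∧
    ∀ s : ℕ, s + 1 = p → ∀ A ∈ ⋀[O]^s (VField O n),
      ω * contractMulti O n A ω = 0 ∧ extDer D ω * contractMulti O n A ω = 0

/-- Infinitesimal deformations `η` of a `p`-form `ω`: `ω + ε η` is integrable modulo `ε²`. Here `ω`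
is integrable, so that only the coefficient of `ε` has to vanish in
`(ω + ε η) ∧ i_A (ω + ε η)` and in `d(ω + ε η) ∧ i_A (ω + ε η)`. -/
def IsInfinitesimalDeformation (D : Fin n → Derivation 𝕜 O O) (p : ℕ) (ω η : DForm O n) : Prop :=
  η ∈ ⋀[O]^p (Module.Dual O (VField O n)) ∧
    ∀ s : ℕ, s + 1 = p → ∀ A ∈ ⋀[O]^s (VField O n),
      ω * contractMulti O n A η + η * contractMulti O n A ω = 0 ∧
      extDer D ω * contractMulti O n A η + extDer D η * contractMulti O n A ω = 0

/-- Nambu structures of order `q ≤ n`: `q`-vector fields `L` for which `i_L Ω` is an integrable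
`(n-q)`-form. -/
def IsNambu (D : Fin n → Derivation 𝕜 O O) (Ω : DForm O n) (q : ℕ) (L : MultiVec O n) : Prop :=
  L ∈ ⋀[O]^q (VField O n) ∧ IsIntegrable D (n - q) (contractMulti O n L Ω)

lemma extDer_add (D : Fin n → Derivation 𝕜 O O) (ω η : DForm O n) :
    extDer D (ω + η) = extDer D ω + extDer D η := by
  simp [extDer, mul_add, Finset.sum_add_distrib]

lemma extDer_smul (D : Fin n → Derivation 𝕜 O O) (c : 𝕜) (ω : DForm O n) :
    extDer D (c • ω) = c • extDer D ω := by
  simp [extDer, Finset.smul_sum]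

lemma contractMulti_smul (c : 𝕜) (A : MultiVec O n) (ω : DForm O n) :
    contractMulti O n A (c • ω) = c • contractMulti O n A ω := by
  rw [← algebraMap_smul O c ω, map_smul, algebraMap_smul]

lemma contractMulti_smul_left (c : 𝕜) (A : MultiVec O n) (ω : DForm O n) :
    contractMulti O n (c • A) ω = c • contractMulti O n A ω := by
  rw [← algebraMap_smul O c A, map_smul, LinearMap.smul_apply, algebraMap_smul]

lemma lieDeriv_add_left (D : Fin n → Derivation 𝕜 O O) (X Y : VField O n) (P : MultiVec O n) :
    lieDeriv D (X + Y) P = lieDeriv D X P + lieDeriv D Y P := by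
  have h : ∀ i, (fun k => D i ((X + Y) k)) = (fun k => D i (X k)) + fun k => D i (Y k) := by
    intro i; ext k; simp
  simp only [lieDeriv]
  simp_rw [h]
  simp only [map_add, add_mul, Pi.add_apply, add_smul, ← Finset.sum_add_distrib]
  exact Finset.sum_congr rfl fun i _ => by abel

lemma lieDeriv_smul_left (D : Fin n → Derivation 𝕜 O O) (c : 𝕜) (X : VField O n)
    (P : MultiVec O n) : lieDeriv D (c • X) P = c • lieDeriv D X P := by
  have h : ∀ i, ExteriorAlgebra.ι O (fun k => D i ((c • X) k)) =
      c • ExteriorAlgebra.ι O (fun k => D i (X k)) := by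
    intro i
    rw [← algebraMap_smul O c (ExteriorAlgebra.ι O _), ← map_smul]
    congr 1
    ext k
    simp [Algebra.smul_def]
  simp only [lieDeriv]
  simp_rw [h]
  simp only [Pi.smul_apply, smul_assoc, Finset.smul_sum, smul_sub, smul_mul_assoc]

/-- `Z(L)`: the infinitesimal deformations of a Nambu structure `L` of order `q ≤ n`, i.e. the
`q`-vector fields `P` such that `i_P Ω` is an infinitesimal deformation of `i_L Ω`. -/
def infinitesimalDeformations (D : Fin n → Derivation 𝕜 O O) (Ω : DForm O n) (q : ℕ)
    (L : MultiVec O n) : Submodule 𝕜 (MultiVec O n) where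
  carrier := {P | P ∈ ⋀[O]^q (VField O n) ∧
    IsInfinitesimalDeformation D (n - q) (contractMulti O n L Ω) (contractMulti O n P Ω)}
  add_mem' := by
    rintro P Q ⟨hP, hP', hP''⟩ ⟨hQ, hQ', hQ''⟩
    refine ⟨add_mem hP hQ, ?_, fun s hs A hA => ?_⟩
    · rw [map_add, LinearMap.add_apply]
      exact add_mem hP' hQ'
    · obtain ⟨h1, h2⟩ := hP'' s hs A hA
      obtain ⟨h3, h4⟩ := hQ'' s hs A hA
      simp only [map_add, LinearMap.add_apply, extDer_add, mul_add, add_mul]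
      refine ⟨?_, ?_⟩
      · rw [add_add_add_comm, h1, h3, add_zero]
      · rw [add_add_add_comm, h2, h4, add_zero]
  zero_mem' := by
    have h0 : extDer D (0 : DForm O n) = 0 := by simp [extDer]
    refine ⟨zero_mem _, ?_, fun s hs A hA => ?_⟩
    · rw [map_zero, LinearMap.zero_apply]
      exact zero_mem _
    · simp [h0]
  smul_mem' := by
    rintro c P ⟨hP, hP', hP''⟩
    refine ⟨?_, ?_, fun s hs A hA => ?_⟩
    · rw [← algebraMap_smul O c P]
      exact Submodule.smul_mem _ _ hP
    · rw [contractMulti_smul_left, ← algebraMap_smul O c (contractMulti O n P Ω)]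
      exact Submodule.smul_mem _ _ hP'
    · obtain ⟨h1, h2⟩ := hP'' s hs A hA
      simp only [contractMulti_smul_left, contractMulti_smul, extDer_smul, mul_smul_comm, smul_mul_assoc,
        ← smul_add]
      exact ⟨by rw [h1, smul_zero], by rw [h2, smul_zero]⟩

/-- `B(L)`: the trivial deformations `L_X L` of `L`, for `X` a vector field. -/
def trivialDeformations (D : Fin n → Derivation 𝕜 O O) (L : MultiVec O n) :
    Submodule 𝕜 (MultiVec O n) where
  carrier := {P | ∃ X : VField O n, P = lieDeriv D X L}
  add_mem' := by
    rintro _ _ ⟨X, rfl⟩ ⟨Y, rfl⟩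
    exact ⟨X + Y, (lieDeriv_add_left D X Y L).symm⟩
  zero_mem' := ⟨0, by simpa using (lieDeriv_smul_left D (0 : 𝕜) 0 L).symm⟩
  smul_mem' := by
    rintro c _ ⟨X, rfl⟩
    exact ⟨c • X, (lieDeriv_smul_left D c X L).symm⟩

/-- The deformation cohomology `DH(L) = Z(L) / B(L)` of a Nambu structure `L` of order `q`. -/
abbrev DH (D : Fin n → Derivation 𝕜 O O) (Ω : DForm O n) (q : ℕ) (L : MultiVec O n) : Type _ :=
  infinitesimalDeformations D Ω q L ⧸
    (trivialDeformations D L).submoduleOf (infinitesimalDeformations D Ω q L)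

variable (O) in
/-- The constant `q`-vector field `∂/∂x_1 ∧ … ∧ ∂/∂x_q`. -/
def constantNambu {q : ℕ} (hqn : q ≤ n) : MultiVec O n :=
  ExteriorAlgebra.ιMulti O q fun i : Fin q => (Pi.single (Fin.castLE hqn i) 1 : VField O n)

end Tensors

end NambuDeformation

end

/-! Write `Λ = ∂_1 ∧ … ∧ ∂_q`; directions with index at most `q` are called leaf directions, the
others transversal. The form `ω = i_Λ(dx_1 ∧ … ∧ dx_n)` is, up to sign, the closed form `dx_{q+1} ∧
… ∧ dx_n`. The unit in the volume form is irrelevant: it multiplies the first condition by `u²` and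
changes the second one only by a multiple of the first (`mem_infinitesimalDeformations_iff`).

The first condition is algebraic. The forms `i_A ω` include all transversal `dx_j`, up to a regular
factor, and wedging with `dx_k` then shows that a deformation `Π` is killed by any two transversal
contractions (`interior_interior_eq_zero_of_decomposable`). Hence `Π` has at most one transversal
factor, which means `Π = β·Λ` for a matrix of functions `β = ∑ β_k ⊗ ∂_k` acting as a derivation
(`exists_linAct_constantNambu`, `linAct_single_constantNambu`).

The second condition is differential. Wedging `d(i_Π Ω)` with a transversal `dx_j` isolates the row
`β_j` (`extDer_contract_linAct_mul_dx`), and vanishing of the result says that the restriction of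
`β_j` to the leaves is closed (`symm_of_sum_dx_dx_constantForm`). The Poincaré lemma along the
leaves, with the transversal coordinates as parameters, yields a potential (`exists_potential`). For
leaf indices only the diagonal entry of `β` acts on `Λ`, and a primitive in one variable suffices.
Since `L_X Λ = -(dX)·Λ` (`lieDeriv_constantNambu`), these potentials form a vector field with `Π =
L_X Λ`. Conversely, every `L_X Λ` is a deformation because second derivatives commute.

The ring enters `constantNambu_rigid` only through commuting partial derivatives and primitives in
`x_i` that stay independent of the variables on which the integrand does not depend. Formal series
are integrated term by term; for functions the primitive is `x_i ∫_0^1 h(…, t x_i, …) dt`, and the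
work lies in its smoothness or analyticity. -/

namespace NambuDeformation

/-! ### Graded calculus of interior multiplication on an exterior algebra. -/

section ExteriorCalculus

open ExteriorAlgebra

variable {R M : Type*} [CommRing R] [AddCommGroup M] [Module R M]

/-- Interior multiplication of the exterior algebra by a linear form. -/
abbrev interior (α : Module.Dual R M) : ExteriorAlgebra R M →ₗ[R] ExteriorAlgebra R M :=
  CliffordAlgebra.contractLeft (Q := (0 : QuadraticForm R M)) α

lemma interior_ι_mul (α : Module.Dual R M) (v : M) (x : ExteriorAlgebra R M) :
    interior α (ι R v * x) = α v • x - ι R v * interior α x :=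
  CliffordAlgebra.contractLeft_ι_mul α v x

lemma interior_algebraMap (α : Module.Dual R M) (r : R) :
    interior α (algebraMap R (ExteriorAlgebra R M) r) = 0 :=
  CliffordAlgebra.contractLeft_algebraMap _ α r

lemma interior_one (α : Module.Dual R M) : interior α (1 : ExteriorAlgebra R M) = 0 :=
  CliffordAlgebra.contractLeft_one _ α

lemma interior_comm (α β : Module.Dual R M) (x : ExteriorAlgebra R M) :
    interior α (interior β x) = -interior β (interior α x) :=
  CliffordAlgebra.contractLeft_comm α β x

lemma interior_self (α : Module.Dual R M) (x : ExteriorAlgebra R M) :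
    interior α (interior α x) = 0 :=
  CliffordAlgebra.contractLeft_contractLeft _ x

lemma ι_mul_ι_comm (v w : M) : ι R v * ι R w = -(ι R w * ι R v) :=
  eq_neg_of_add_eq_zero_left (ι_add_mul_swap v w)

lemma ι_mul_ι_mul_comm (v w : M) (x : ExteriorAlgebra R M) :
    ι R v * (ι R w * x) = -(ι R w * (ι R v * x)) := by
  rw [← mul_assoc, ι_mul_ι_comm, neg_mul, mul_assoc]

/-- Induction on elements of the exterior algebra by left multiplication with vectors. -/
lemma exterior_induction {C : ExteriorAlgebra R M → Prop}
    (algebraMap : ∀ r : R, C (algebraMap R (ExteriorAlgebra R M) r))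
    (add : ∀ x y, C x → C y → C (x + y)) (ι_mul : ∀ x v, C x → C (ι R v * x)) (x) : C x :=
  CliffordAlgebra.left_induction (Q := (0 : QuadraticForm R M)) algebraMap add ι_mul x

/-- Induction on elements of fixed degree. -/
lemma exteriorPower_induction {C : ℕ → ExteriorAlgebra R M → Prop}
    (algebraMap : ∀ r : R, C 0 (algebraMap R (ExteriorAlgebra R M) r))
    (add : ∀ m x y, C m x → C m y → C m (x + y))
    (ι_mul : ∀ m x v, x ∈ ⋀[R]^m M → C m x → C (m + 1) (ι R v * x)) {m : ℕ} {x}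
    (hx : x ∈ ⋀[R]^m M) : C m x := by
  refine Submodule.pow_induction_on_left' (M := LinearMap.range (ι R : M →ₗ[R] _))
    (C := fun m x _ => C m x) algebraMap (fun x y i _ _ h h' => add i x y h h') ?_ hx
  rintro _ ⟨v, rfl⟩ i x hx h
  exact ι_mul i x v hx h

lemma ι_mul_mem {m : ℕ} {x : ExteriorAlgebra R M} (v : M) (hx : x ∈ ⋀[R]^m M) :
    ι R v * x ∈ ⋀[R]^(m + 1) M := by
  change _ ∈ LinearMap.range (ι R : M →ₗ[R] _) ^ (m + 1)
  rw [pow_succ']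
  exact Submodule.mul_mem_mul ⟨v, rfl⟩ hx

lemma exterior_mul_mem {k m : ℕ} {x y : ExteriorAlgebra R M} (hx : x ∈ ⋀[R]^k M)
    (hy : y ∈ ⋀[R]^m M) : x * y ∈ ⋀[R]^(k + m) M := by
  change _ ∈ LinearMap.range (ι R : M →ₗ[R] _) ^ (k + m)
  rw [pow_add]
  exact Submodule.mul_mem_mul hx hy

lemma exists_algebraMap_of_mem {x : ExteriorAlgebra R M} (hx : x ∈ ⋀[R]^0 M) :
    ∃ r : R, x = algebraMap R _ r := by
  change x ∈ LinearMap.range (ι R : M →ₗ[R] _) ^ 0 at hx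
  rw [pow_zero] at hx
  obtain ⟨r, rfl⟩ := Submodule.mem_one.1 hx
  exact ⟨r, rfl⟩

lemma exists_ι_of_mem {x : ExteriorAlgebra R M} (hx : x ∈ ⋀[R]^1 M) : ∃ v : M, x = ι R v := by
  change x ∈ LinearMap.range (ι R : M →ₗ[R] _) ^ 1 at hx
  rw [pow_one] at hx
  obtain ⟨v, rfl⟩ := hx
  exact ⟨v, rfl⟩

lemma ιMulti_mem {m : ℕ} (v : Fin m → M) : ιMulti R m v ∈ ⋀[R]^m M := by
  rw [← ιMulti_span_fixedDegree]
  exact Submodule.subset_span ⟨v, rfl⟩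

/-- The vanishing in degree 0 is carried along because the induction step from degree 0 to 1 needs
`ι v * interior α x` to disappear there. -/
lemma interior_mem_aux (α : Module.Dual R M) {m : ℕ} {x : ExteriorAlgebra R M}
    (hx : x ∈ ⋀[R]^m M) :
    (m = 0 → interior α x = 0) ∧ ∀ k, m = k + 1 → interior α x ∈ ⋀[R]^k M := by
  refine exteriorPower_induction
    (C := fun m x => (m = 0 → interior α x = 0) ∧ ∀ k, m = k + 1 → interior α x ∈ ⋀[R]^k M)
    (fun r => ⟨fun _ => interior_algebraMap α r, fun k hk => by simp at hk⟩) ?_ ?_ hx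
  · rintro m x y ⟨h1, h2⟩ ⟨h3, h4⟩
    refine ⟨fun hm => ?_, fun k hk => ?_⟩
    · rw [map_add, h1 hm, h3 hm, add_zero]
    · rw [map_add]; exact add_mem (h2 k hk) (h4 k hk)
  · rintro m x v hx ⟨h1, h2⟩
    refine ⟨fun hm => by simp at hm, fun k hk => ?_⟩
    obtain rfl : m = k := by omega
    rw [interior_ι_mul]
    refine sub_mem (Submodule.smul_mem _ _ hx) ?_
    cases m with
    | zero => rw [h1 rfl, mul_zero]; exact zero_mem _
    | succ k => exact ι_mul_mem v (h2 k rfl)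

lemma interior_mem (α : Module.Dual R M) {m : ℕ} {x : ExteriorAlgebra R M}
    (hx : x ∈ ⋀[R]^(m + 1) M) : interior α x ∈ ⋀[R]^m M :=
  (interior_mem_aux α hx).2 m rfl

lemma interior_eq_zero_of_mem_zero (α : Module.Dual R M) {x : ExteriorAlgebra R M}
    (hx : x ∈ ⋀[R]^0 M) : interior α x = 0 :=
  (interior_mem_aux α hx).1 rfl

lemma mul_ι_of_mem {m : ℕ} {x : ExteriorAlgebra R M} (hx : x ∈ ⋀[R]^m M) (v : M) :
    x * ι R v = (-1 : R) ^ m • (ι R v * x) := by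
  refine exteriorPower_induction
    (C := fun m x => x * ι R v = (-1 : R) ^ m • (ι R v * x)) (fun r => ?_) ?_ ?_ hx
  · rw [pow_zero, one_smul, Algebra.commutes]
  · intro m x y h h'
    rw [add_mul, h, h', mul_add, smul_add]
  · intro m x w _ h
    rw [mul_assoc, h, mul_smul_comm, ι_mul_ι_mul_comm, pow_succ, mul_neg_one, neg_smul, smul_neg]

lemma mul_ι_eq_zero_iff {m : ℕ} {x : ExteriorAlgebra R M} (hx : x ∈ ⋀[R]^m M) (v : M) :
    x * ι R v = 0 ↔ ι R v * x = 0 := by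
  rw [mul_ι_of_mem hx]
  constructor
  · intro h
    have := congrArg (fun y => (-1 : R) ^ m • y) h
    simpa [smul_smul, ← mul_pow] using this
  · intro h
    rw [h, smul_zero]

lemma ι_mul_ιMulti_eq_zero {m : ℕ} (v : Fin m → M) (i : Fin m) : ι R (v i) * ιMulti R m v = 0 := by
  rw [ιMulti_apply]
  exact ι_mul_prod_list v i

lemma interior_ιMulti_eq_zero (α : Module.Dual R M) {m : ℕ} (v : Fin m → M)
    (h : ∀ i, α (v i) = 0) : interior α (ιMulti R m v) = 0 := by
  induction m with
  | zero => rw [ιMulti_zero_apply, interior_one]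
  | succ m ih =>
    rw [ιMulti_succ_apply, interior_ι_mul, h, zero_smul, zero_sub,
      ih (Matrix.vecTail v) fun i => h i.succ, mul_zero, neg_zero]

/-- The graded Leibniz rule for interior multiplication. -/
lemma interior_mul (α : Module.Dual R M) {m : ℕ} {x : ExteriorAlgebra R M} (hx : x ∈ ⋀[R]^m M)
    (y : ExteriorAlgebra R M) :
    interior α (x * y) = interior α x * y + (-1 : R) ^ m • (x * interior α y) := by
  refine exteriorPower_induction
    (C := fun m x => interior α (x * y) = interior α x * y + (-1 : R) ^ m • (x * interior α y))
    (fun r => ?_) ?_ ?_ hx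
  · rw [interior_algebraMap, zero_mul, zero_add, pow_zero, one_smul, ← Algebra.smul_def,
      map_smul, Algebra.smul_def]
  · intro m x z h h'
    rw [add_mul, map_add, h, h', map_add, add_mul, add_mul, smul_add]
    abel
  · intro m x v _ h
    rw [mul_assoc, interior_ι_mul, h, interior_ι_mul, pow_succ, mul_neg_one, neg_smul, mul_add,
      sub_mul, smul_mul_assoc, mul_smul_comm, mul_assoc, mul_assoc]
    abel

/-- The derivation of the exterior algebra extending the rank one endomorphism `α(·) v`. -/
lemma ι_mul_interior_mul (α : Module.Dual R M) (v : M) (x y : ExteriorAlgebra R M) :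
    ι R v * interior α (x * y) = ι R v * interior α x * y + x * (ι R v * interior α y) := by
  refine exterior_induction (C := fun x => ι R v * interior α (x * y) =
    ι R v * interior α x * y + x * (ι R v * interior α y)) (fun r => ?_) ?_ ?_ x
  · rw [interior_algebraMap, mul_zero, zero_mul, zero_add, ← Algebra.smul_def, map_smul,
      mul_smul_comm, Algebra.smul_def]
  · intro x z h h'
    rw [add_mul, map_add, mul_add, h, h', map_add, mul_add, add_mul, add_mul]
    abel
  · intro x w h
    rw [mul_assoc, interior_ι_mul, interior_ι_mul, mul_sub, mul_sub, ι_mul_ι_mul_comm, h, sub_mul,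
      mul_smul_comm, mul_smul_comm, ι_mul_ι_mul_comm v w (interior α x)]
    simp only [mul_add, smul_mul_assoc, mul_assoc, neg_mul]
    abel

/-! ### Coordinates in the basis of an exterior algebra. -/

section Basis

variable {n : ℕ} (b : Module.Basis (Fin n) R M)

/-- The Euler identity: the identity endomorphism extends to multiplication by the degree. -/
lemma sum_ι_mul_interior {m : ℕ} {x : ExteriorAlgebra R M} (hx : x ∈ ⋀[R]^m M) :
    ∑ i, ι R (b i) * interior (b.coord i) x = m • x := by
  refine exteriorPower_induction
    (C := fun m x => ∑ i, ι R (b i) * interior (b.coord i) x = m • x) (fun r => ?_) ?_ ?_ hx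
  · simp
  · intro m x y h h'
    simp only [map_add, mul_add, Finset.sum_add_distrib, h, h', smul_add]
  · intro m x v _ h
    have hv : ι R v = ∑ i, b.coord i v • ι R (b i) := by
      conv_lhs => rw [← b.sum_repr v]
      simp only [map_sum, map_smul, Module.Basis.coord_apply]
    simp only [interior_ι_mul, mul_sub, ι_mul_ι_mul_comm _ v, Finset.sum_sub_distrib,
      mul_smul_comm, Finset.sum_neg_distrib]
    rw [← Finset.mul_sum, h, add_smul, one_smul, sub_neg_eq_add, mul_smul_comm, add_comm]
    congr 1
    rw [hv, Finset.sum_mul]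
    simp

lemma basis_eq_ιMulti (I : Finset (Fin n)) :
    b.ExteriorAlgebra I = ιMulti R I.card (b ∘ I.orderEmbOfFin rfl) := by
  rw [ExteriorAlgebra.basis_apply]
  rfl

lemma basis_mem_exteriorPower (I : Finset (Fin n)) : b.ExteriorAlgebra I ∈ ⋀[R]^I.card M := by
  rw [basis_eq_ιMulti]
  exact ιMulti_mem _

lemma basis_empty : b.ExteriorAlgebra ∅ = 1 := by
  rw [basis_eq_ιMulti]
  exact ιMulti_zero_apply _

/-- A wedge product of distinct basis vectors is an element of the basis, up to sign. -/
lemma ιMulti_comp_injective {m : ℕ} (g : Fin m → Fin n) (hg : Function.Injective g) :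
    ∃ ε : ℤˣ, ιMulti R m (b ∘ g) = ε • b.ExteriorAlgebra (Finset.univ.image g) := by
  have hc : (Finset.univ.image g).card = m := by
    rw [Finset.card_image_of_injective _ hg, Finset.card_univ, Fintype.card_fin]
  have hb : b.ExteriorAlgebra (Finset.univ.image g) =
      ιMulti R m (b ∘ (Finset.univ.image g).orderEmbOfFin hc) := by
    rw [ExteriorAlgebra.basis_apply_ofCard b hc]
    rfl
  have hmem : ∀ i, g i ∈ Finset.univ.image g := fun i => Finset.mem_image_of_mem _ (Finset.mem_univ i)
  let o := (Finset.univ.image g).orderIsoOfFin hc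
  let f : Fin m → Fin m := fun i => o.symm ⟨g i, hmem i⟩
  have hf : Function.Injective f := fun i j hij => by
    have := o.symm.injective hij
    exact hg (Subtype.ext_iff.1 this)
  let σ : Equiv.Perm (Fin m) := Equiv.ofBijective f (Finite.injective_iff_bijective.1 hf)
  refine ⟨σ.sign, ?_⟩
  rw [hb, ← AlternatingMap.map_perm]
  congr 1
  ext i
  simp only [Function.comp_apply]
  congr 1
  change g i = (Finset.univ.image g).orderEmbOfFin hc (f i)
  rw [← Finset.coe_orderIsoOfFin_apply]
  change g i = (o (o.symm ⟨g i, hmem i⟩) : Fin n)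
  rw [OrderIso.apply_symm_apply]

lemma ι_mul_basis_of_mem {i : Fin n} {I : Finset (Fin n)} (hi : i ∈ I) :
    ι R (b i) * b.ExteriorAlgebra I = 0 := by
  rw [basis_eq_ιMulti]
  have h : i ∈ Set.range (I.orderEmbOfFin rfl) := by
    rw [Finset.range_orderEmbOfFin]
    exact hi
  obtain ⟨k, rfl⟩ := h
  exact ι_mul_ιMulti_eq_zero (b ∘ I.orderEmbOfFin rfl) k

lemma ι_mul_basis_of_notMem {i : Fin n} {I : Finset (Fin n)} (hi : i ∉ I) :
    ∃ ε : ℤˣ, ι R (b i) * b.ExteriorAlgebra I = ε • b.ExteriorAlgebra (insert i I) := by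
  have hg : Function.Injective (Fin.cons i (I.orderEmbOfFin rfl) : Fin (I.card + 1) → Fin n) := by
    rw [Fin.cons_injective_iff]
    refine ⟨?_, (I.orderEmbOfFin rfl).injective⟩
    rw [Finset.range_orderEmbOfFin]
    exact hi
  obtain ⟨ε, hε⟩ := ιMulti_comp_injective (R := R) b _ hg
  refine ⟨ε, ?_⟩
  have h1 : Finset.univ.image (Fin.cons i (I.orderEmbOfFin rfl) : Fin (I.card + 1) → Fin n) =
      insert i I := by
    rw [← Finset.coe_inj]
    simp [Fin.range_cons]
  rw [h1] at hε
  rw [← hε, ιMulti_succ_apply, basis_eq_ιMulti]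
  rfl

lemma interior_basis_of_notMem {i : Fin n} {I : Finset (Fin n)} (hi : i ∉ I) :
    interior (b.coord i) (b.ExteriorAlgebra I) = 0 := by
  rw [basis_eq_ιMulti]
  refine interior_ιMulti_eq_zero _ _ fun k => ?_
  have h : I.orderEmbOfFin rfl k ≠ i := by
    rintro rfl
    exact hi (Finset.orderEmbOfFin_mem _ _ _)
  simp [h]

lemma interior_ι_mul_basis {i : Fin n} {I : Finset (Fin n)} (hi : i ∉ I) :
    interior (b.coord i) (ι R (b i) * b.ExteriorAlgebra I) = b.ExteriorAlgebra I := by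
  rw [interior_ι_mul, interior_basis_of_notMem b hi, mul_zero, sub_zero]
  simp

/-- Such an `x` equals the contraction of `e_i ∧ x`, and wedging with `e_i` kills every basis
element that contains `e_i`. -/
lemma repr_eq_zero_of_interior_eq_zero {i : Fin n} {x : ExteriorAlgebra R M}
    (hx : interior (b.coord i) x = 0) {I : Finset (Fin n)} (hi : i ∈ I) :
    b.ExteriorAlgebra.repr x I = 0 := by
  classical
  have h1 : x = interior (b.coord i) (ι R (b i) * x) := by
    rw [interior_ι_mul, hx, mul_zero, sub_zero]
    simp
  have h2 : x = ∑ K, (if i ∈ K then 0 else b.ExteriorAlgebra.repr x K) • b.ExteriorAlgebra K := by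
    conv_lhs => rw [h1, ← b.ExteriorAlgebra.sum_repr x, Finset.mul_sum, map_sum]
    refine Finset.sum_congr rfl fun K _ => ?_
    rw [mul_smul_comm, map_smul]
    split_ifs with h
    · rw [ι_mul_basis_of_mem b h, map_zero, smul_zero, zero_smul]
    · rw [interior_ι_mul_basis b h]
  conv_lhs => rw [h2]
  rw [b.ExteriorAlgebra.repr_sum_self]
  simp [hi]

/-- The Euler operator multiplies `x` by `m` and the basis element of `I` by `|I|`. Comparing
coefficients leaves a nonzero integer times the coordinate. -/
lemma repr_eq_zero_of_mem {m : ℕ} [IsAddTorsionFree R] {x : ExteriorAlgebra R M}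
    (hx : x ∈ ⋀[R]^m M) {I : Finset (Fin n)} (hI : I.card ≠ m) :
    b.ExteriorAlgebra.repr x I = 0 := by
  have h1 := sum_ι_mul_interior b hx
  have h2 : ∑ K, (K.card • b.ExteriorAlgebra.repr x K) • b.ExteriorAlgebra K = m • x := by
    rw [← h1]
    conv_rhs => rw [← b.ExteriorAlgebra.sum_repr x]
    simp only [map_sum, map_smul, Finset.mul_sum, mul_smul_comm]
    rw [Finset.sum_comm]
    refine Finset.sum_congr rfl fun K _ => ?_
    rw [← Finset.smul_sum, sum_ι_mul_interior b (basis_mem_exteriorPower b K), smul_comm, smul_assoc]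
  have h3 := congrArg (fun y => b.ExteriorAlgebra.repr y I) h2
  simp only [b.ExteriorAlgebra.repr_sum_self, map_nsmul, Finsupp.smul_apply] at h3
  by_contra h0
  have h4 : ((I.card : ℤ) - m) • b.ExteriorAlgebra.repr x I = 0 := by
    rw [sub_smul, natCast_zsmul, natCast_zsmul, h3, sub_self]
  rw [IsAddTorsionFree.zsmul_eq_zero_iff_left h0] at h4
  omega

lemma smul_eq_zero_of_forall_smul (b : Module.Basis (Fin n) R M) {c : R} (hc : ∀ r : R, c * r = 0 → r = 0)
    {x : ExteriorAlgebra R M} (hx : c • x = 0) : x = 0 := by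
  refine b.ExteriorAlgebra.repr.injective (Finsupp.ext fun I => ?_)
  rw [map_zero, Finsupp.zero_apply]
  refine hc _ ?_
  rw [← smul_eq_mul, ← Finsupp.smul_apply, ← map_smul, hx, map_zero, Finsupp.zero_apply]

/-- The elements with integral coordinates. -/
def integralSpan : AddSubgroup (ExteriorAlgebra R M) :=
  AddSubgroup.closure (Set.range b.ExteriorAlgebra)

lemma basis_mem_integralSpan (I : Finset (Fin n)) : b.ExteriorAlgebra I ∈ integralSpan b :=
  AddSubgroup.subset_closure ⟨I, rfl⟩

lemma units_smul_basis_mem_integralSpan (ε : ℤˣ) (I : Finset (Fin n)) :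
    ε • b.ExteriorAlgebra I ∈ integralSpan b :=
  AddSubgroup.zsmul_mem _ (basis_mem_integralSpan b I) _

/-- Stability of integral elements allows forms to be recognised as having constant coefficients
without computing any sign. -/
lemma ι_mul_mem_integralSpan (i : Fin n) {x : ExteriorAlgebra R M} (hx : x ∈ integralSpan b) :
    ι R (b i) * x ∈ integralSpan b := by
  induction hx using AddSubgroup.closure_induction with
  | mem x hx =>
    obtain ⟨I, rfl⟩ := hx
    by_cases hi : i ∈ I
    · rw [ι_mul_basis_of_mem b hi]
      exact zero_mem _
    · obtain ⟨ε, hε⟩ := ι_mul_basis_of_notMem b hi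
      rw [hε]
      exact units_smul_basis_mem_integralSpan b ε _
  | zero => rw [mul_zero]; exact zero_mem _
  | add x y _ _ h h' => rw [mul_add]; exact add_mem h h'
  | neg x _ h => rw [mul_neg]; exact neg_mem h

lemma ιMulti_mem_integralSpan {m : ℕ} (g : Fin m → Fin n) :
    ιMulti R m (b ∘ g) ∈ integralSpan b := by
  induction m with
  | zero =>
    rw [ιMulti_zero_apply, ← basis_empty b]
    exact basis_mem_integralSpan b _
  | succ m ih =>
    rw [ιMulti_succ_apply]
    exact ι_mul_mem_integralSpan b _ (ih (g ∘ Fin.succ))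

/-- Arbitrary lists `g` are used instead of increasing ones, so that the tail of a product is again
of the same kind. -/
lemma interior_ιMulti_mem_integralSpan {m : ℕ} (i : Fin n) (g : Fin m → Fin n) :
    interior (b.coord i) (ιMulti R m (b ∘ g)) ∈ integralSpan b := by
  induction m with
  | zero => rw [ιMulti_zero_apply, interior_one]; exact zero_mem _
  | succ m ih =>
    have h1 : ιMulti R (m + 1) (b ∘ g) = ι R (b (g 0)) * ιMulti R m (b ∘ (g ∘ Fin.succ)) := by
      rw [ιMulti_succ_apply]; rfl
    rw [h1, interior_ι_mul]
    refine sub_mem ?_ (ι_mul_mem_integralSpan b _ (ih _))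
    by_cases h : g 0 = i
    · simpa [h] using ιMulti_mem_integralSpan b (g ∘ Fin.succ)
    · simp [h, zero_mem]

lemma interior_mem_integralSpan (i : Fin n) {x : ExteriorAlgebra R M} (hx : x ∈ integralSpan b) :
    interior (b.coord i) x ∈ integralSpan b := by
  induction hx using AddSubgroup.closure_induction with
  | mem x hx =>
    obtain ⟨I, rfl⟩ := hx
    rw [basis_eq_ιMulti]
    exact interior_ιMulti_mem_integralSpan b i _
  | zero => rw [map_zero]; exact zero_mem _
  | add x y _ _ h h' => rw [map_add]; exact add_mem h h'
  | neg x _ h => rw [map_neg]; exact neg_mem h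

end Basis

end ExteriorCalculus

/-! ### Contraction of forms by multivector fields, linear actions and the volume form. -/

section Contraction

open ExteriorAlgebra

variable {O : Type*} [CommRing O] {n : ℕ}

variable (O) in
/-- The coordinate vector field `∂/∂x_i`. -/
abbrev pd (i : Fin n) : VField O n := Pi.single i 1

/-- Interior multiplication of forms by a vector field. -/
abbrev interiorVec (X : VField O n) : DForm O n →ₗ[O] DForm O n :=
  interior (Module.Dual.eval O (VField O n) X)

lemma dx_pd (i j : Fin n) : dx O i (pd O j) = if i = j then 1 else 0 := by
  simp [dx, pd, Pi.single_apply]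

lemma basisFun_coord (i : Fin n) : (Pi.basisFun O (Fin n)).coord i = dx O i := by
  ext j
  simp [dx]

lemma basisFun_eq_pd (i : Fin n) : Pi.basisFun O (Fin n) i = pd O i := by
  simp [pd]

lemma dualBasis_eq_dx (i : Fin n) : (Pi.basisFun O (Fin n)).dualBasis i = dx O i := by
  rw [← basisFun_coord]
  simp

lemma dualBasis_coord (i : Fin n) :
    (Pi.basisFun O (Fin n)).dualBasis.coord i = Module.Dual.eval O (VField O n) (pd O i) := by
  refine LinearMap.ext fun α => ?_
  simp [pd]

lemma dual_eq_sum_dx (α : Module.Dual O (VField O n)) : α = ∑ i, α (pd O i) • dx O i := by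
  refine (Pi.basisFun O (Fin n)).ext fun j => ?_
  simp [dx, Pi.single_apply]

lemma interiorVec_ι_mul (X : VField O n) (α : Module.Dual O (VField O n)) (w : DForm O n) :
    interiorVec X (ι O α * w) = α X • w - ι O α * interiorVec X w :=
  interior_ι_mul _ _ _

lemma contractMulti_ι (X : VField O n) : contractMulti O n (ι O X) = interiorVec X := by
  rw [contractMulti, lift_ι_apply]
  rfl

lemma contractMulti_ι_mul (X : VField O n) (A : MultiVec O n) (w : DForm O n) :
    contractMulti O n (ι O X * A) w = interiorVec X (contractMulti O n A w) := by
  rw [map_mul, contractMulti_ι, Module.End.mul_apply]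

lemma contractMulti_mul (A B : MultiVec O n) (w : DForm O n) :
    contractMulti O n (A * B) w = contractMulti O n A (contractMulti O n B w) := by
  rw [map_mul, Module.End.mul_apply]

lemma contractMulti_algebraMap (c : O) (w : DForm O n) :
    contractMulti O n (algebraMap O _ c) w = c • w := by
  rw [AlgHom.commutes, Module.algebraMap_end_apply]

lemma contractMulti_smul_left' (c : O) (A : MultiVec O n) (w : DForm O n) :
    contractMulti O n (c • A) w = c • contractMulti O n A w := by
  rw [map_smul, LinearMap.smul_apply]

lemma contractMulti_mem {a : ℕ} {A : MultiVec O n} (hA : A ∈ ⋀[O]^a (VField O n)) {m : ℕ}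
    {w : DForm O n} (hw : w ∈ ⋀[O]^(m + a) (Module.Dual O (VField O n))) :
    contractMulti O n A w ∈ ⋀[O]^m (Module.Dual O (VField O n)) := by
  refine exteriorPower_induction (C := fun a A => ∀ (m : ℕ) (w : DForm O n),
    w ∈ ⋀[O]^(m + a) (Module.Dual O (VField O n)) →
    contractMulti O n A w ∈ ⋀[O]^m (Module.Dual O (VField O n))) ?_ ?_ ?_ hA m w hw
  · intro r m w hw
    rw [contractMulti_algebraMap]
    exact Submodule.smul_mem _ _ hw
  · intro a x y h h' m w hw
    rw [map_add, LinearMap.add_apply]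
    exact add_mem (h m w hw) (h' m w hw)
  · intro a x v _ h m w hw
    rw [contractMulti_ι_mul]
    exact interior_mem _ (h (m + 1) w (by rwa [add_assoc, add_comm 1 a]))

/-- Moving `α` past each `i_X` costs a term `α(X)`, and it finally meets `w`, which it annihilates;
the collected terms are the antiderivation formula for `i_α A`. For the volume form the hypothesis
is automatic, so wedging with `α` becomes contraction of the multivector field. -/
lemma ι_mul_contractMulti {α : Module.Dual O (VField O n)} {w : DForm O n} (hw : ι O α * w = 0)
    (A : MultiVec O n) :
    ι O α * contractMulti O n A w = contractMulti O n (interior α A) w := by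
  refine exterior_induction (C := fun A => ι O α * contractMulti O n A w =
    contractMulti O n (interior α A) w) (fun r => ?_) ?_ ?_ A
  · rw [contractMulti_algebraMap, interior_algebraMap, map_zero, LinearMap.zero_apply,
      mul_smul_comm, hw, smul_zero]
  · intro x y h h'
    rw [map_add, LinearMap.add_apply, mul_add, h, h', map_add, map_add, LinearMap.add_apply]
  · intro x v h
    have h1 := interiorVec_ι_mul v α (contractMulti O n x w)
    rw [h] at h1
    rw [contractMulti_ι_mul, interior_ι_mul, map_sub, LinearMap.sub_apply, contractMulti_ι_mul,
      contractMulti_smul_left', h1]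
    abel

/-! #### Infinitesimal linear transformations -/

/-- The action on multivector fields of the infinitesimal linear transformation `∑ α_k ⊗ ∂/∂x_k`. -/
def linAct (α : Fin n → Module.Dual O (VField O n)) : MultiVec O n →ₗ[O] MultiVec O n :=
  ∑ k, LinearMap.mulLeft O (ι O (pd O k)) ∘ₗ interior (α k)

/-- The dual action on forms. -/
def linActForm (α : Fin n → Module.Dual O (VField O n)) : DForm O n →ₗ[O] DForm O n :=
  ∑ k, LinearMap.mulLeft O (ι O (α k)) ∘ₗ interiorVec (pd O k)

lemma linAct_apply (α : Fin n → Module.Dual O (VField O n)) (A : MultiVec O n) :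
    linAct α A = ∑ k, ι O (pd O k) * interior (α k) A := by
  simp [linAct]

lemma linActForm_apply (α : Fin n → Module.Dual O (VField O n)) (w : DForm O n) :
    linActForm α w = ∑ k, ι O (α k) * interiorVec (pd O k) w := by
  simp [linActForm]

lemma linActForm_mul (α : Fin n → Module.Dual O (VField O n)) (v w : DForm O n) :
    linActForm α (v * w) = linActForm α v * w + v * linActForm α w := by
  simp only [linActForm_apply, Finset.sum_mul, Finset.mul_sum, ← Finset.sum_add_distrib]
  exact Finset.sum_congr rfl fun k _ => ι_mul_interior_mul _ _ _ _

lemma linAct_add (α β : Fin n → Module.Dual O (VField O n)) (A : MultiVec O n) :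
    linAct (α + β) A = linAct α A + linAct β A := by
  simp [linAct_apply, mul_add, Finset.sum_add_distrib]

lemma linAct_mem (α : Fin n → Module.Dual O (VField O n)) {m : ℕ} {A : MultiVec O n}
    (hA : A ∈ ⋀[O]^m (VField O n)) : linAct α A ∈ ⋀[O]^m (VField O n) := by
  rw [linAct_apply]
  refine sum_mem fun k _ => ?_
  cases m with
  | zero => rw [interior_eq_zero_of_mem_zero _ hA, mul_zero]; exact zero_mem _
  | succ m => exact ι_mul_mem _ (interior_mem _ hA)

lemma interiorVec_linActForm (α : Fin n → Module.Dual O (VField O n)) (X : VField O n)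
    (w : DForm O n) :
    interiorVec X (linActForm α w) =
      linActForm α (interiorVec X w) + ∑ k, α k X • interiorVec (pd O k) w := by
  simp only [linActForm_apply, map_sum, interiorVec_ι_mul, ← Finset.sum_add_distrib]
  refine Finset.sum_congr rfl fun k _ => ?_
  rw [interior_comm (Module.Dual.eval O (VField O n) X), mul_neg, sub_neg_eq_add, add_comm]

lemma linAct_ι_mul (α : Fin n → Module.Dual O (VField O n)) (X : VField O n)
    (A : MultiVec O n) :
    linAct α (ι O X * A) = ι O X * linAct α A + ∑ k, α k X • (ι O (pd O k) * A) := by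
  simp only [linAct_apply, interior_ι_mul, Finset.mul_sum, ← Finset.sum_add_distrib]
  refine Finset.sum_congr rfl fun k _ => ?_
  rw [mul_sub, ι_mul_ι_mul_comm, sub_neg_eq_add, mul_smul_comm, add_comm]

/-- This is the naturality of contraction under linear maps, differentiated. The sign is a plus
because forms carry the transpose action, the negative of the contragredient one. -/
lemma contractMulti_linActForm (α : Fin n → Module.Dual O (VField O n)) (A : MultiVec O n)
    (w : DForm O n) :
    contractMulti O n A (linActForm α w) =
      linActForm α (contractMulti O n A w) + contractMulti O n (linAct α A) w := by
  refine exterior_induction (C := fun A => contractMulti O n A (linActForm α w) =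
      linActForm α (contractMulti O n A w) + contractMulti O n (linAct α A) w)
    (fun r => ?_) ?_ ?_ A
  · rw [contractMulti_algebraMap, contractMulti_algebraMap, map_smul, linAct_apply]
    simp only [interior_algebraMap, mul_zero, Finset.sum_const_zero, map_zero,
      LinearMap.zero_apply, add_zero]
  · intro x y h h'
    simp only [map_add, LinearMap.add_apply, h, h']
    abel
  · intro x v h
    rw [contractMulti_ι_mul, h, map_add, interiorVec_linActForm, contractMulti_ι_mul,
      linAct_ι_mul, map_add, LinearMap.add_apply, contractMulti_ι_mul, map_sum,
      LinearMap.sum_apply]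
    simp only [contractMulti_smul_left', contractMulti_ι_mul]
    abel

/-! #### The standard volume form -/

variable (O n) in
/-- The form `dx_1 ∧ … ∧ dx_n`. -/
abbrev stdVolume : DForm O n := ιMulti O n (dx O)

lemma ι_mul_stdVolume (α : Module.Dual O (VField O n)) : ι O α * stdVolume O n = 0 := by
  rw [dual_eq_sum_dx α, map_sum, Finset.sum_mul]
  refine Finset.sum_eq_zero fun i _ => ?_
  rw [map_smul, smul_mul_assoc, ι_mul_ιMulti_eq_zero, smul_zero]

lemma stdVolume_mem : stdVolume O n ∈ ⋀[O]^n (Module.Dual O (VField O n)) := ιMulti_mem _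

lemma ι_mul_contract_stdVolume (α : Module.Dual O (VField O n)) (A : MultiVec O n) :
    ι O α * contractMulti O n A (stdVolume O n) =
      contractMulti O n (interior α A) (stdVolume O n) :=
  ι_mul_contractMulti (ι_mul_stdVolume α) A

/-- The trace of the linear transformation `∑ α_k ⊗ ∂/∂x_k`. -/
def linTrace (α : Fin n → Module.Dual O (VField O n)) : O := ∑ k, α k (pd O k)

/-- Contract the vanishing form `α_k ∧ dx_1 ∧ … ∧ dx_n` with `∂_k` and sum over `k`. -/
lemma linActForm_stdVolume (α : Fin n → Module.Dual O (VField O n)) :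
    linActForm α (stdVolume O n) = linTrace α • stdVolume O n := by
  rw [linActForm_apply, linTrace, Finset.sum_smul]
  refine Finset.sum_congr rfl fun k _ => ?_
  have h := interiorVec_ι_mul (pd O k) (α k) (stdVolume O n)
  rw [ι_mul_stdVolume, map_zero] at h
  exact (sub_eq_zero.1 h.symm).symm

lemma contract_linAct_stdVolume (α : Fin n → Module.Dual O (VField O n)) (A : MultiVec O n) :
    contractMulti O n (linAct α A) (stdVolume O n) =
      linTrace α • contractMulti O n A (stdVolume O n) -
        linActForm α (contractMulti O n A (stdVolume O n)) := by
  have h := contractMulti_linActForm α A (stdVolume O n)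
  rw [linActForm_stdVolume, map_smul] at h
  rw [h]
  abel

lemma units_smul_basis_eq_zero {M : Type*} [AddCommGroup M] [Module O M]
    (b : Module.Basis (Finset (Fin n)) O M) {ε : ℤˣ} {I : Finset (Fin n)} {c : O}
    (h : c • ε • b I = 0) : c = 0 := by
  have h1 : c • b I = 0 := by
    rcases Int.units_eq_one_or ε with rfl | rfl
    · simpa using h
    · simpa using h
  have h2 := congrArg (fun y => b.repr y I) h1
  simpa using h2

lemma smul_stdVolume_eq_zero {c : O} (h : c • stdVolume O n = 0) : c = 0 := by
  obtain ⟨ε, hε⟩ := ιMulti_comp_injective (R := O) (Pi.basisFun O (Fin n)).dualBasis id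
    Function.injective_id
  have h1 : (Pi.basisFun O (Fin n)).dualBasis ∘ id = dx O := funext fun i => dualBasis_eq_dx i
  rw [h1] at hε
  rw [stdVolume, hε] at h
  exact units_smul_basis_eq_zero _ h

lemma smul_ιMulti_pd_eq_zero {m : ℕ} {g : Fin m → Fin n} (hg : Function.Injective g) {c : O}
    (h : c • ιMulti O m (fun i => pd O (g i)) = 0) : c = 0 := by
  obtain ⟨ε, hε⟩ := ιMulti_comp_injective (R := O) (Pi.basisFun O (Fin n)) g hg
  have h1 : Pi.basisFun O (Fin n) ∘ g = fun i => pd O (g i) := funext fun i => basisFun_eq_pd _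
  rw [h1] at hε
  rw [hε] at h
  exact units_smul_basis_eq_zero _ h

/-- Contraction with the volume form is injective in each degree. -/
lemma eq_zero_of_contract_stdVolume [IsAddTorsionFree O] {m : ℕ} {P : MultiVec O n}
    (hP : P ∈ ⋀[O]^m (VField O n)) (h : contractMulti O n P (stdVolume O n) = 0) : P = 0 := by
  induction m generalizing P with
  | zero =>
    obtain ⟨c, rfl⟩ := exists_algebraMap_of_mem hP
    rw [contractMulti_algebraMap] at h
    rw [smul_stdVolume_eq_zero h, map_zero]
  | succ m ih =>
    -- The contraction of `P` by `dx_k` corresponds to `dx_k ∧ i_P Ω = 0` and has lower degree. Once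
    -- all these vanish, Euler's identity reads `(m + 1) P = 0`.
    have h1 : ∀ k, interior (dx O k) P = 0 := fun k => by
      refine ih (interior_mem _ hP) ?_
      rw [← ι_mul_contract_stdVolume, h, mul_zero]
    have h2 := sum_ι_mul_interior (Pi.basisFun O (Fin n)) hP
    simp only [basisFun_coord, h1, mul_zero, Finset.sum_const_zero] at h2
    refine smul_eq_zero_of_forall_smul (Pi.basisFun O (Fin n)) (c := ((m + 1 : ℕ) : O)) ?_ ?_
    · intro r hr
      rw [← nsmul_eq_mul] at hr
      exact (nsmul_eq_zero_iff_right (by omega)).1 hr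
    · rw [Nat.cast_smul_eq_nsmul, ← h2]

end Contraction

/-! ### The algebraic deformation condition at the constant multivector field. -/

section ConstantNambu

open ExteriorAlgebra

variable {O : Type*} [CommRing O] {n q : ℕ} (hqn : q ≤ n)

lemma constantNambu_mem : constantNambu O hqn ∈ ⋀[O]^q (VField O n) := ιMulti_mem _

lemma pd_mul_constantNambu {i : Fin n} (hi : (i : ℕ) < q) :
    ι O (pd O i) * constantNambu O hqn = 0 :=
  ι_mul_ιMulti_eq_zero (fun k : Fin q => pd O (Fin.castLE hqn k)) ⟨i, hi⟩

lemma interior_constantNambu {α : Module.Dual O (VField O n)}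
    (h : ∀ i : Fin n, (i : ℕ) < q → α (pd O i) = 0) : interior α (constantNambu O hqn) = 0 :=
  interior_ιMulti_eq_zero _ _ fun i => h _ i.2

lemma interior_dx_constantNambu {j : Fin n} (hj : q ≤ (j : ℕ)) :
    interior (dx O j) (constantNambu O hqn) = 0 := by
  refine interior_constantNambu hqn fun i hi => ?_
  rw [dx_pd, if_neg]
  rintro rfl
  omega

lemma smul_constantNambu_eq_zero {c : O} (h : c • constantNambu O hqn = 0) : c = 0 :=
  smul_ιMulti_pd_eq_zero (Fin.castLE_injective hqn) h

lemma image_castLE : Finset.univ.image (Fin.castLE hqn) =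
    Finset.univ.filter fun i : Fin n => (i : ℕ) < q := by
  ext i
  simp only [Finset.mem_image, Finset.mem_univ, true_and, Finset.mem_filter]
  exact ⟨by rintro ⟨k, rfl⟩; exact k.2, fun h => ⟨⟨i, h⟩, rfl⟩⟩

lemma constantNambu_eq_basis :
    ∃ ε : ℤˣ, constantNambu O hqn = ε • (Pi.basisFun O (Fin n)).ExteriorAlgebra
      (Finset.univ.filter fun i : Fin n => (i : ℕ) < q) := by
  obtain ⟨ε, hε⟩ := ιMulti_comp_injective (R := O) (Pi.basisFun O (Fin n)) (Fin.castLE hqn)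
    (Fin.castLE_injective hqn)
  refine ⟨ε, ?_⟩
  have h1 : Pi.basisFun O (Fin n) ∘ Fin.castLE hqn = fun i => pd O (Fin.castLE hqn i) :=
    funext fun i => basisFun_eq_pd _
  rw [h1, image_castLE] at hε
  exact hε

/-- The form `i_Λ (dx_1 ∧ … ∧ dx_n)` for the constant multivector field `Λ`, i.e.
`dx_{q+1} ∧ … ∧ dx_n` up to sign. -/
abbrev constantForm : DForm O n := contractMulti O n (constantNambu O hqn) (stdVolume O n)

lemma contract_stdVolume_mem (hqn : q ≤ n) {P : MultiVec O n} (hP : P ∈ ⋀[O]^q (VField O n)) :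
    contractMulti O n P (stdVolume O n) ∈ ⋀[O]^(n - q) (Module.Dual O (VField O n)) :=
  contractMulti_mem hP (by rw [Nat.sub_add_cancel hqn]; exact stdVolume_mem)

lemma constantForm_mem : constantForm (O := O) hqn ∈ ⋀[O]^(n - q) (Module.Dual O (VField O n)) :=
  contract_stdVolume_mem hqn (constantNambu_mem hqn)

lemma ι_mul_constantForm (α : Module.Dual O (VField O n)) :
    ι O α * constantForm hqn = contractMulti O n (interior α (constantNambu O hqn))
      (stdVolume O n) :=
  ι_mul_contract_stdVolume _ _

lemma dx_mul_constantForm {j : Fin n} (hj : q ≤ (j : ℕ)) :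
    ι O (dx O j) * constantForm hqn = 0 := by
  rw [ι_mul_constantForm, interior_dx_constantNambu hqn hj, map_zero, LinearMap.zero_apply]

/-- For a leaf direction, `i_{∂_i} i_A i_Λ` is up to sign `i_A i_{∂_i ∧ Λ}`, and `∂_i ∧ Λ = 0`. -/
lemma contractMulti_constantForm {s : ℕ} (hs : s + 1 = n - q) {A : MultiVec O n}
    (hA : A ∈ ⋀[O]^s (VField O n)) :
    ∃ θ : Module.Dual O (VField O n), contractMulti O n A (constantForm hqn) = ι O θ ∧
      ∀ i : Fin n, (i : ℕ) < q → θ (pd O i) = 0 := by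
  have h1 : contractMulti O n A (constantForm hqn) ∈ ⋀[O]^1 (Module.Dual O (VField O n)) := by
    refine contractMulti_mem hA ?_
    rw [add_comm, hs]
    exact constantForm_mem hqn
  obtain ⟨θ, hθ⟩ := exists_ι_of_mem h1
  refine ⟨θ, hθ, fun i hi => ?_⟩
  have h2 : interiorVec (pd O i) (contractMulti O n A (constantForm hqn)) = 0 := by
    have h3 : ι O (pd O i) * A = (-1 : O) ^ s • (A * ι O (pd O i)) := by
      rw [mul_ι_of_mem hA, smul_smul, ← mul_pow]
      simp
    rw [← contractMulti_ι_mul, h3, contractMulti_smul_left', contractMulti_mul, constantForm,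
      ← contractMulti_mul (ι O (pd O i)), pd_mul_constantNambu hqn hi, map_zero, LinearMap.zero_apply, map_zero,
      smul_zero]
  rw [hθ] at h2
  have h4 := interiorVec_ι_mul (pd O i) θ 1
  rw [mul_one, h2, interior_one, mul_zero, sub_zero] at h4
  have h5 : algebraMap O (DForm O n) (θ (pd O i)) = 0 := by
    rw [Algebra.algebraMap_eq_smul_one, ← h4]
  exact (algebraMap_eq_zero_iff _ _).1 h5

/-- A form `θ` that vanishes on the leaves satisfies `i_θ Λ = 0`, and this contraction corresponds
to `θ ∧ ω`. -/
lemma constantForm_mul_contract {s : ℕ} (hs : s + 1 = n - q) {A : MultiVec O n}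
    (hA : A ∈ ⋀[O]^s (VField O n)) :
    constantForm hqn * contractMulti O n A (constantForm hqn) = 0 := by
  obtain ⟨θ, hθ, h0⟩ := contractMulti_constantForm hqn hs hA
  rw [hθ, mul_ι_eq_zero_iff (constantForm_mem hqn), ι_mul_constantForm,
    interior_constantNambu hqn h0, map_zero, LinearMap.zero_apply]

/-- The first condition on infinitesimal deformations holds along the linear group action. -/
lemma linAct_constantNambu_decomposable (α : Fin n → Module.Dual O (VField O n)) {s : ℕ}
    (hs : s + 1 = n - q) {A : MultiVec O n} (hA : A ∈ ⋀[O]^s (VField O n)) :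
    constantForm hqn * contractMulti O n A
        (contractMulti O n (linAct α (constantNambu O hqn)) (stdVolume O n)) +
      contractMulti O n (linAct α (constantNambu O hqn)) (stdVolume O n) *
        contractMulti O n A (constantForm hqn) = 0 := by
  have h1 := constantForm_mul_contract hqn hs hA
  -- The identity `ω ∧ i_A ω = 0` is differentiated along the action. Since `A` moves as well, it is
  -- also needed for the transformed `A`.
  have h2 := constantForm_mul_contract hqn hs (linAct_mem α hA)
  have h3 := linActForm_mul α (constantForm hqn) (contractMulti O n A (constantForm hqn))
  rw [h1, map_zero] at h3
  rw [contract_linAct_stdVolume, map_sub, map_smul, contractMulti_linActForm, mul_sub, mul_add,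
    sub_mul, mul_smul_comm, smul_mul_assoc, h1, h2]
  simp only [smul_zero, zero_sub, add_zero]
  rw [← neg_add, add_comm, ← h3, neg_zero]

/-- Contractions of the constant form give all `dx_j`, `j > q`, up to a regular factor. -/
lemma exists_contract_constantForm [IsAddTorsionFree O] {s : ℕ} (hs : s + 1 = n - q) {j : Fin n}
    (hj : q ≤ (j : ℕ)) :
    ∃ A ∈ ⋀[O]^s (VField O n), ∃ c : O, (∀ r, c * r = 0 → r = 0) ∧
      contractMulti O n A (constantForm hqn) = c • ι O (dx O j) := by
  have hn : s + 1 + q = n := by omega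
  -- `g` lists the transversal indices, so `B ∧ Λ` is a wedge of all coordinate fields and pairs
  -- with the volume form to a scalar `c`. Only the regularity of `c` is needed, not its value.
  let g : Fin (s + 1) → Fin n := fun k => Fin.cast hn ((Fin.natAdd q k).cast (add_comm _ _))
  let B : MultiVec O n := ιMulti O (s + 1) fun k => pd O (g k)
  have hB : B ∈ ⋀[O]^(s + 1) (VField O n) := ιMulti_mem _
  let g' : Fin (s + 1 + q) → Fin n := Fin.append g (Fin.castLE hqn)
  have hg' : Function.Injective g' := by
    rw [Fin.append_injective_iff]
    refine ⟨fun k l h => ?_, Fin.castLE_injective hqn, fun k l h => ?_⟩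
    · have h1 := congrArg Fin.val h
      simp only [g, Fin.val_cast, Fin.val_natAdd] at h1
      exact Fin.ext (by omega)
    · have h1 := congrArg Fin.val h
      simp only [g, Fin.val_cast, Fin.val_natAdd, Fin.val_castLE] at h1
      omega
  have hT : B * constantNambu O hqn = ιMulti O (s + 1 + q) fun k => pd O (g' k) := by
    rw [constantNambu]
    simp only [B]
    rw [ιMulti_mul_ιMulti]
    congr 1
    funext k
    refine Fin.addCases (fun k => ?_) (fun k => ?_) k
    · simp [g']
    · simp [g']
  have hTmem : B * constantNambu O hqn ∈ ⋀[O]^n (VField O n) := by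
    have := exterior_mul_mem hB (constantNambu_mem (O := O) hqn)
    rwa [hn] at this
  have h0 : contractMulti O n (B * constantNambu O hqn) (stdVolume O n) ∈
      ⋀[O]^0 (Module.Dual O (VField O n)) :=
    contractMulti_mem hTmem (by rw [zero_add]; exact stdVolume_mem)
  obtain ⟨c, hc⟩ := exists_algebraMap_of_mem h0
  -- Since `dx_j` kills `Λ`, contracting `B` alone is the same as contracting `B ∧ Λ`, which
  -- corresponds to wedging `c` with `dx_j`.
  refine ⟨interior (dx O j) B, interior_mem _ hB, c, fun r hr => ?_, ?_⟩
  · have h1 : r • (B * constantNambu O hqn) = 0 := by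
      refine eq_zero_of_contract_stdVolume (Submodule.smul_mem _ r hTmem) ?_
      rw [contractMulti_smul_left', hc, Algebra.smul_def, ← map_mul, mul_comm, hr, map_zero]
    rw [hT] at h1
    exact smul_ιMulti_pd_eq_zero hg' h1
  · have h1 := interior_mul (dx O j) hB (constantNambu O hqn)
    rw [interior_dx_constantNambu hqn hj, mul_zero, smul_zero, add_zero] at h1
    rw [constantForm, ← contractMulti_mul, ← h1, ← ι_mul_contract_stdVolume, hc,
      Algebra.algebraMap_eq_smul_one, mul_smul_comm, mul_one]

/-- Take `A` with `i_A ω = c dx_j` and wedge the condition with `dx_k` from the left. The first term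
dies because `dx_k ∧ ω = 0`; the other one is a double contraction of `P`, seen through the volume
form. -/
lemma interior_interior_eq_zero_of_decomposable [IsAddTorsionFree O] {P : MultiVec O n}
    (hP : P ∈ ⋀[O]^q (VField O n))
    (h : ∀ s : ℕ, s + 1 = n - q → ∀ A ∈ ⋀[O]^s (VField O n),
      constantForm hqn * contractMulti O n A (contractMulti O n P (stdVolume O n)) +
        contractMulti O n P (stdVolume O n) * contractMulti O n A (constantForm hqn) = 0)
    {j k : Fin n} (hj : q ≤ (j : ℕ)) (hk : q ≤ (k : ℕ)) :
    interior (dx O k) (interior (dx O j) P) = 0 := by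
  obtain ⟨s, hs⟩ : ∃ s, s + 1 = n - q := ⟨n - q - 1, by omega⟩
  obtain ⟨A, hA, c, hc, hAc⟩ := exists_contract_constantForm (O := O) hqn hs hj
  have h1 := h s hs A hA
  have hη := contract_stdVolume_mem hqn hP
  have h2 : (ι O (dx O k) * contractMulti O n P (stdVolume O n)) * ι O (c • dx O j) = 0 := by
    have h3 := congrArg (fun y => ι O (dx O k) * y) h1
    simp only [mul_add, mul_zero, ← mul_assoc] at h3
    rw [dx_mul_constantForm hqn hk, zero_mul, zero_add, hAc] at h3
    rw [map_smul]
    exact h3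
  rw [mul_ι_eq_zero_iff (ι_mul_mem _ hη), map_smul, ι_mul_contract_stdVolume, smul_mul_assoc,
    ι_mul_contract_stdVolume, ← contractMulti_smul_left'] at h2
  rw [interior_comm, neg_eq_zero]
  refine smul_eq_zero_of_forall_smul (Pi.basisFun O (Fin n)) hc ?_
  -- Injectivity of contraction with the volume form is applied in degree `q - 2`; below that the
  -- double contraction vanishes for degree reasons.
  rcases Nat.lt_or_ge q 2 with hq | hq
  · obtain hq | hq : q = 0 ∨ q = 1 := by omega
    · subst hq
      rw [interior_eq_zero_of_mem_zero _ hP, map_zero, smul_zero]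
    · subst hq
      rw [interior_eq_zero_of_mem_zero _ (interior_mem (m := 0) _ hP), smul_zero]
  · obtain ⟨m, rfl⟩ : ∃ m, q = m + 1 + 1 := ⟨q - 2, by omega⟩
    exact eq_zero_of_contract_stdVolume
      (Submodule.smul_mem _ _ (interior_mem _ (interior_mem _ hP))) h2

/-- Coordinates of `x` at index sets with a transversal element or of the wrong size vanish, so only
leafwise basis elements contribute. -/
lemma mem_of_support_constantNambu [IsAddTorsionFree O] {m : ℕ} {x : MultiVec O n}
    (hx : x ∈ ⋀[O]^m (VField O n)) (h : ∀ j : Fin n, q ≤ (j : ℕ) → interior (dx O j) x = 0)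
    (S : Submodule O (MultiVec O n))
    (hS : ∀ I : Finset (Fin n), (∀ i ∈ I, (i : ℕ) < q) → I.card = m →
      (Pi.basisFun O (Fin n)).ExteriorAlgebra I ∈ S) : x ∈ S := by
  rw [← (Pi.basisFun O (Fin n)).ExteriorAlgebra.sum_repr x]
  refine sum_mem fun I _ => ?_
  by_cases hI : ∀ i ∈ I, (i : ℕ) < q
  · by_cases hm : I.card = m
    · exact Submodule.smul_mem _ _ (hS I hI hm)
    · rw [repr_eq_zero_of_mem _ hx hm, zero_smul]
      exact zero_mem _
  · push Not at hI
    obtain ⟨i, hi, hq⟩ := hI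
    rw [repr_eq_zero_of_interior_eq_zero _ (by rw [basisFun_coord]; exact h i hq) hi, zero_smul]
    exact zero_mem _

include hqn in
lemma card_filter_val_lt_of_le : (Finset.univ.filter fun i : Fin n => (i : ℕ) < q).card = q := by
  rw [← image_castLE hqn, Finset.card_image_of_injective _ (Fin.castLE_injective hqn), Finset.card_univ,
    Fintype.card_fin]

lemma basis_eq_constantNambu {I : Finset (Fin n)} (hI : ∀ i ∈ I, (i : ℕ) < q) (hc : I.card = q) :
    ∃ ε : ℤˣ, (Pi.basisFun O (Fin n)).ExteriorAlgebra I = ε • constantNambu O hqn := by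
  have h1 : I = Finset.univ.filter fun i : Fin n => (i : ℕ) < q := by
    refine Finset.eq_of_subset_of_card_le (fun i hi => by simpa using hI i hi) ?_
    rw [card_filter_val_lt_of_le hqn, hc]
  obtain ⟨ε, hε⟩ := constantNambu_eq_basis (O := O) hqn
  refine ⟨ε, ?_⟩
  rw [hε, ← h1, smul_smul, ← sq, Int.units_sq, one_smul]

lemma units_smul_mem {M : Type*} [AddCommGroup M] [Module O M] (S : Submodule O M) (ε : ℤˣ) {x : M}
    (hx : x ∈ S) : ε • x ∈ S := by
  rcases Int.units_eq_one_or ε with rfl | rfl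
  · simpa using hx
  · simpa using hx

lemma exists_smul_constantNambu [IsAddTorsionFree O] {Q : MultiVec O n}
    (hQ : Q ∈ ⋀[O]^q (VField O n)) (h : ∀ j : Fin n, q ≤ (j : ℕ) → interior (dx O j) Q = 0) :
    ∃ f : O, Q = f • constantNambu O hqn := by
  have h1 := mem_of_support_constantNambu hQ h (Submodule.span O {constantNambu O hqn})
    fun I hI hc => by
      obtain ⟨ε, hε⟩ := basis_eq_constantNambu (O := O) hqn hI hc
      rw [hε]
      exact units_smul_mem _ _ (Submodule.mem_span_singleton_self _)
  obtain ⟨f, hf⟩ := Submodule.mem_span_singleton.1 h1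
  exact ⟨f, hf.symm⟩

/-- A leafwise basis element of degree `q - 1` misses some leaf index `i`. Wedging with `∂_i` gives
`±Λ`, and contracting by `dx_i` recovers the element; linearity in `α` covers combinations. -/
lemma exists_interior_constantNambu [IsAddTorsionFree O] {m : ℕ} (hm : m + 1 = q)
    {x : MultiVec O n} (hx : x ∈ ⋀[O]^m (VField O n))
    (h : ∀ j : Fin n, q ≤ (j : ℕ) → interior (dx O j) x = 0) :
    ∃ α : Module.Dual O (VField O n), x = interior α (constantNambu O hqn) := by
  let S : Submodule O (MultiVec O n) := LinearMap.range
    ((CliffordAlgebra.contractLeft (Q := (0 : QuadraticForm O (VField O n)))).flip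
      (constantNambu O hqn))
  have h1 : x ∈ S := by
    refine mem_of_support_constantNambu hx h S fun I hI hc => ?_
    obtain ⟨i, hi, hiI⟩ : ∃ i ∈ Finset.univ.filter (fun i : Fin n => (i : ℕ) < q), i ∉ I := by
      refine Finset.exists_mem_notMem_of_card_lt_card ?_
      rw [card_filter_val_lt_of_le hqn]
      omega
    obtain ⟨ε, hε⟩ := ι_mul_basis_of_notMem (R := O) (Pi.basisFun O (Fin n)) hiI
    obtain ⟨ε', hε'⟩ := basis_eq_constantNambu (O := O) (I := insert i I) hqn
      (by
        intro k hk
        rcases Finset.mem_insert.1 hk with rfl | hk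
        · simpa using hi
        · exact hI k hk)
      (by rw [Finset.card_insert_of_notMem hiI]; omega)
    rw [← interior_ι_mul_basis _ hiI, hε, hε', basisFun_coord, smul_smul]
    have h2 : interior (dx O i) ((ε * ε') • constantNambu O hqn) =
        (ε * ε') • interior (dx O i) (constantNambu O hqn) :=
      map_zsmul (interior (dx O i)) ((ε * ε' : ℤˣ) : ℤ) _
    rw [h2]
    exact units_smul_mem _ _ ⟨dx O i, rfl⟩
  obtain ⟨α, hα⟩ := h1
  exact ⟨α, hα.symm⟩

/-- Multivector fields with at most one factor transversal to the leaves are tangent to the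
orbit of the constant one under linear transformations. -/
lemma exists_linAct_constantNambu [IsAddTorsionFree O] (hq : 1 ≤ q) {P : MultiVec O n}
    (hP : P ∈ ⋀[O]^q (VField O n))
    (h : ∀ j k : Fin n, q ≤ (j : ℕ) → q ≤ (k : ℕ) → interior (dx O k) (interior (dx O j) P) = 0) :
    ∃ (f : O) (α : Fin n → Module.Dual O (VField O n)),
      P = f • constantNambu O hqn + linAct α (constantNambu O hqn) := by
  obtain ⟨m, rfl⟩ : ∃ m, q = m + 1 := ⟨q - 1, by omega⟩
  -- For transversal `k` the contraction of `P` by `dx_k` has no transversal factor left, so it has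
  -- the form `i_{α_k} Λ`. Subtracting `∑ ∂_k ∧ i_{α_k} Λ` then removes all transversal factors of
  -- `P`.
  have h1 : ∀ k : Fin n, ∃ α : Module.Dual O (VField O n), ((k : ℕ) < m + 1 → α = 0) ∧
      (m + 1 ≤ (k : ℕ) → interior (dx O k) P = interior α (constantNambu O hqn)) := fun k => by
    by_cases hk : (k : ℕ) < m + 1
    · exact ⟨0, fun _ => rfl, fun h => by omega⟩
    · obtain ⟨α, hα⟩ := exists_interior_constantNambu hqn rfl (interior_mem (dx O k) hP)
        fun j hj => h k j (by omega) hj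
      exact ⟨α, fun h => by omega, fun _ => hα⟩
  choose α hα0 hα using h1
  have h2 : ∃ f : O, P - linAct α (constantNambu O hqn) = f • constantNambu O hqn := by
    refine exists_smul_constantNambu hqn (sub_mem hP (linAct_mem α (constantNambu_mem hqn)))
      fun j hj => ?_
    rw [linAct_apply, map_sub, map_sum, Finset.sum_eq_single j]
    · rw [← hα j hj, interior_ι_mul, interior_self, mul_zero, sub_zero, dx_pd, if_pos rfl, one_smul,
        sub_self]
    · intro k _ hk
      rw [interior_ι_mul, dx_pd, if_neg hk.symm, zero_smul, zero_sub, neg_eq_zero]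
      by_cases hkq : (k : ℕ) < m + 1
      · rw [hα0 k hkq]
        simp
      · rw [← hα k (by omega), h k j (by omega) hj, mul_zero]
    · simp
  obtain ⟨f, hf⟩ := h2
  exact ⟨f, α, by rw [← hf]; abel⟩

lemma pd_mul_interior_constantNambu (α : Module.Dual O (VField O n)) {i : Fin n}
    (hi : (i : ℕ) < q) :
    ι O (pd O i) * interior α (constantNambu O hqn) = α (pd O i) • constantNambu O hqn := by
  have h := interior_ι_mul α (pd O i) (constantNambu O hqn)
  rw [pd_mul_constantNambu hqn hi, map_zero] at h
  exact (sub_eq_zero.1 h.symm).symm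

/-- Putting two leaf vectors back recovers a multiple of `Λ`, the factor being the 2×2 minor of `α,
β` on these vectors. -/
lemma pd_mul_pd_mul_interior_interior (α β : Module.Dual O (VField O n)) {i j : Fin n}
    (hi : (i : ℕ) < q) (hj : (j : ℕ) < q) :
    ι O (pd O j) * (ι O (pd O i) * interior α (interior β (constantNambu O hqn))) =
      (α (pd O i) * β (pd O j) - α (pd O j) * β (pd O i)) • constantNambu O hqn := by
  have h := interior_ι_mul α (pd O i) (interior β (constantNambu O hqn))
  rw [pd_mul_interior_constantNambu hqn β hi, map_smul] at h
  have h1 : ι O (pd O i) * interior α (interior β (constantNambu O hqn)) =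
      α (pd O i) • interior β (constantNambu O hqn) -
        β (pd O i) • interior α (constantNambu O hqn) := by
    rw [h]
    abel
  rw [h1, mul_sub, mul_smul_comm, mul_smul_comm, pd_mul_interior_constantNambu hqn β hj,
    pd_mul_interior_constantNambu hqn α hj, smul_smul, smul_smul, ← sub_smul]
  congr 1
  ring

/-- The form `∑ c_{ij} dx_i ∧ dx_j ∧ ω`, with `ω` the constant form, vanishes only if `c` is
symmetric along the leaves. -/
lemma symm_of_sum_dx_dx_constantForm [IsAddTorsionFree O] {c : Fin n → Fin n → O}
    (h : ∑ i, ∑ j, c i j • (ι O (dx O i) * (ι O (dx O j) * constantForm hqn)) = 0) {i j : Fin n}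
    (hi : (i : ℕ) < q) (hj : (j : ℕ) < q) : c i j = c j i := by
  by_cases hij : i = j
  · rw [hij]
  obtain ⟨m, rfl⟩ : ∃ m, q = m + 1 + 1 :=
    ⟨q - 2, by have := fun h => hij (Fin.ext h); omega⟩
  have h1 : ∑ k, ∑ l, c k l • interior (dx O k) (interior (dx O l) (constantNambu O hqn)) = 0 := by
    refine eq_zero_of_contract_stdVolume (m := m) (sum_mem fun k _ => sum_mem fun l _ =>
      Submodule.smul_mem _ _ (interior_mem _ (interior_mem _ (constantNambu_mem hqn)))) ?_
    rw [← h]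
    simp only [map_sum, LinearMap.sum_apply, contractMulti_smul_left',
      ι_mul_contract_stdVolume]
  -- The minors of `dx_k, dx_l` on `∂_i, ∂_j` select exactly `c i j - c j i` as the coefficient of
  -- `Λ`.
  have h2 := congrArg (fun y => ι O (pd O j) * (ι O (pd O i) * y)) h1
  simp only [Finset.mul_sum, mul_smul_comm, pd_mul_pd_mul_interior_interior hqn _ _ hi hj,
    smul_smul, mul_zero, ← Finset.sum_smul] at h2
  have h3 := smul_constantNambu_eq_zero hqn h2
  simp only [dx_pd, mul_sub, Finset.sum_sub_distrib, mul_ite, mul_one, mul_zero,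
    Finset.sum_ite_eq', Finset.mem_univ, if_true] at h3
  have h4 : c i j - c j i = 0 := by
    rw [← h3]
  exact sub_eq_zero.1 h4

end ConstantNambu

/-! ### The differential condition, and rigidity over an abstract ring of functions. -/

section Deformations

open ExteriorAlgebra

variable {𝕜 : Type*} [Field 𝕜] {O : Type*} [CommRing O] [Algebra 𝕜 O] {n q : ℕ} (hqn : q ≤ n)
  (D : Fin n → Derivation 𝕜 O O)

section Coefficients

variable {M : Type*} [AddCommGroup M] [Module O M] [Module 𝕜 M] [IsScalarTower 𝕜 O M]
  (b : Module.Basis (Finset (Fin n)) O M) (δ : Derivation 𝕜 O O)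

lemma coeffDeriv_apply (m : M) : coeffDeriv b δ m = ∑ I, δ (b.repr m I) • b I := rfl

lemma coeffDeriv_smul (f : O) (m : M) :
    coeffDeriv b δ (f • m) = δ f • m + f • coeffDeriv b δ m := by
  have h : δ f • m = ∑ I, δ f • b.repr m I • b I := by
    rw [← Finset.smul_sum, b.sum_repr]
  rw [h, coeffDeriv_apply, coeffDeriv_apply, Finset.smul_sum, ← Finset.sum_add_distrib]
  refine Finset.sum_congr rfl fun I _ => ?_
  rw [map_smul, Finsupp.smul_apply, smul_eq_mul, Derivation.leibniz, smul_smul, smul_smul,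
    ← add_smul, smul_eq_mul, smul_eq_mul]
  congr 1
  ring

lemma coeffDeriv_basis (I : Finset (Fin n)) : coeffDeriv b δ (b I) = 0 := by
  classical
  rw [coeffDeriv_apply]
  refine Finset.sum_eq_zero fun K _ => ?_
  rw [b.repr_self, Finsupp.single_apply]
  split_ifs <;> simp

lemma coeffDeriv_eq_zero {m : M} (hm : m ∈ AddSubgroup.closure (Set.range b)) :
    coeffDeriv b δ m = 0 := by
  induction hm using AddSubgroup.closure_induction with
  | mem x hx =>
    obtain ⟨I, rfl⟩ := hx
    exact coeffDeriv_basis b δ I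
  | zero => exact map_zero _
  | add x y _ _ h h' => rw [map_add, h, h', add_zero]
  | neg x _ h => rw [map_neg, h, neg_zero]

end Coefficients

/-- The differential of a function. -/
def grad (f : O) : Module.Dual O (VField O n) := ∑ i, D i f • dx O i

lemma grad_pd (f : O) (i : Fin n) : grad D f (pd O i) = D i f := by
  simp [grad, dx_pd]

lemma ι_grad_mul (f : O) (w : DForm O n) :
    ι O (grad D f) * w = ∑ i, D i f • (ι O (dx O i) * w) := by
  simp [grad, Finset.sum_mul]

lemma extDer_smul_function (f : O) (w : DForm O n) :
    extDer D (f • w) = ι O (grad D f) * w + f • extDer D w := by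
  rw [ι_grad_mul]
  simp only [extDer, coeffDeriv_smul, mul_add, mul_smul_comm, Finset.sum_add_distrib,
    Finset.smul_sum]

lemma extDer_sum {κ : Type*} (s : Finset κ) (w : κ → DForm O n) :
    extDer D (∑ k ∈ s, w k) = ∑ k ∈ s, extDer D (w k) := by
  simp only [extDer, map_sum, Finset.mul_sum]
  rw [Finset.sum_comm]

lemma extDer_sub (v w : DForm O n) : extDer D (v - w) = extDer D v - extDer D w := by
  simp [extDer, mul_sub]

/-- Integers are constants for every derivation. -/
lemma extDer_integral {w : DForm O n} (hw : w ∈ integralSpan (Pi.basisFun O (Fin n)).dualBasis) :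
    extDer D w = 0 := by
  refine Finset.sum_eq_zero fun i _ => ?_
  rw [formBasis, coeffDeriv_eq_zero _ _ hw, mul_zero]

lemma extDer_smul_integral (f : O) {w : DForm O n}
    (hw : w ∈ integralSpan (Pi.basisFun O (Fin n)).dualBasis) :
    extDer D (f • w) = ι O (grad D f) * w := by
  rw [extDer_smul_function, extDer_integral D hw, smul_zero, add_zero]

lemma dx_mul_mem_integralSpan (i : Fin n) {w : DForm O n}
    (hw : w ∈ integralSpan (Pi.basisFun O (Fin n)).dualBasis) :
    ι O (dx O i) * w ∈ integralSpan (Pi.basisFun O (Fin n)).dualBasis := by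
  rw [← dualBasis_eq_dx]
  exact ι_mul_mem_integralSpan _ i hw

lemma interiorVec_mem_integralSpan (i : Fin n) {w : DForm O n}
    (hw : w ∈ integralSpan (Pi.basisFun O (Fin n)).dualBasis) :
    interiorVec (pd O i) w ∈ integralSpan (Pi.basisFun O (Fin n)).dualBasis := by
  rw [interiorVec, ← dualBasis_coord]
  exact interior_mem_integralSpan _ i hw

lemma contract_ιMulti_mem_integralSpan {m : ℕ} (g : Fin m → Fin n) {w : DForm O n}
    (hw : w ∈ integralSpan (Pi.basisFun O (Fin n)).dualBasis) :
    contractMulti O n (ιMulti O m fun k => pd O (g k)) w ∈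
      integralSpan (Pi.basisFun O (Fin n)).dualBasis := by
  induction m with
  | zero =>
    rw [ιMulti_zero_apply, map_one]
    exact hw
  | succ m ih =>
    rw [ιMulti_succ_apply, contractMulti_ι_mul]
    exact interiorVec_mem_integralSpan _ (ih fun k => g k.succ)

lemma stdVolume_mem_integralSpan :
    stdVolume O n ∈ integralSpan (Pi.basisFun O (Fin n)).dualBasis := by
  have h := ιMulti_mem_integralSpan (R := O) (Pi.basisFun O (Fin n)).dualBasis id
  have h1 : (Pi.basisFun O (Fin n)).dualBasis ∘ id = dx O := funext fun i => dualBasis_eq_dx i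
  rwa [h1] at h

lemma constantForm_mem_integralSpan :
    constantForm hqn ∈ integralSpan (Pi.basisFun O (Fin n)).dualBasis :=
  contract_ιMulti_mem_integralSpan _ stdVolume_mem_integralSpan

lemma linActForm_eq_sum (α : Fin n → Module.Dual O (VField O n)) (w : DForm O n) :
    linActForm α w =
      ∑ k, ∑ i, α k (pd O i) • (ι O (dx O i) * interiorVec (pd O k) w) := by
  rw [linActForm_apply]
  refine Finset.sum_congr rfl fun k _ => ?_
  conv_lhs => rw [dual_eq_sum_dx (α k)]
  simp only [map_sum, map_smul, Finset.sum_mul, smul_mul_assoc]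

/-- After the action is moved to forms, everything is a function times a constant-coefficient form,
so `d` only sees the trace and the matrix entries. -/
lemma extDer_contract_linAct (α : Fin n → Module.Dual O (VField O n)) :
    extDer D (contractMulti O n (linAct α (constantNambu O hqn)) (stdVolume O n)) =
      ι O (grad D (linTrace α)) * constantForm hqn -
        ∑ k, ∑ i, ι O (grad D (α k (pd O i))) *
          (ι O (dx O i) * interiorVec (pd O k) (constantForm hqn)) := by
  have hω := constantForm_mem_integralSpan (O := O) hqn
  rw [contract_linAct_stdVolume, extDer_sub, extDer_smul_integral D _ hω, linActForm_eq_sum,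
    extDer_sum]
  simp only [extDer_sum]
  congr 1
  refine Finset.sum_congr rfl fun k _ => Finset.sum_congr rfl fun i _ => ?_
  exact extDer_smul_integral D _ (dx_mul_mem_integralSpan i (interiorVec_mem_integralSpan k hω))

/-- As `ω ∧ dx_j = 0`, the trace term drops out, and `i_{∂_k} ω ∧ dx_j` is `±ω` for `k = j` and zero
otherwise. Only row `j` of the matrix survives. -/
lemma extDer_contract_linAct_mul_dx (α : Fin n → Module.Dual O (VField O n)) {s : ℕ}
    (hs : s + 1 = n - q) {j : Fin n} (hj : q ≤ (j : ℕ)) :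
    extDer D (contractMulti O n (linAct α (constantNambu O hqn)) (stdVolume O n)) *
        ι O (dx O j) = -(-1 : O) ^ s • ∑ l, ∑ i, D l (α j (pd O i)) •
          (ι O (dx O l) * (ι O (dx O i) * constantForm hqn)) := by
  have hω : constantForm (O := O) hqn ∈ ⋀[O]^(s + 1) (Module.Dual O (VField O n)) := by
    rw [hs]; exact constantForm_mem hqn
  have h1 : constantForm hqn * ι O (dx O j) = 0 := by
    rw [mul_ι_eq_zero_iff hω, dx_mul_constantForm hqn hj]
  have h2 : ∀ k, interiorVec (pd O k) (constantForm hqn) * ι O (dx O j) =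
      if j = k then (-1 : O) ^ s • constantForm hqn else 0 := fun k => by
    have h := interiorVec_ι_mul (pd O k) (dx O j) (constantForm hqn)
    rw [dx_mul_constantForm hqn hj, map_zero, dx_pd] at h
    rw [mul_ι_of_mem (interior_mem _ hω), ← sub_eq_zero.1 h.symm]
    split_ifs <;> simp
  rw [extDer_contract_linAct, sub_mul, mul_assoc, h1, mul_zero, zero_sub, Finset.sum_mul,
    Finset.sum_eq_single j, neg_smul, Finset.smul_sum]
  · rw [Finset.sum_mul, Finset.sum_congr rfl fun l _ => Finset.smul_sum, Finset.sum_comm]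
    congr 1
    refine Finset.sum_congr rfl fun i _ => ?_
    rw [mul_assoc, mul_assoc, h2, if_pos rfl, mul_smul_comm, mul_smul_comm, ι_grad_mul,
      Finset.smul_sum]
  · intro k _ hk
    rw [Finset.sum_mul]
    refine Finset.sum_eq_zero fun i _ => ?_
    rw [mul_assoc, mul_assoc, h2, if_neg hk.symm, mul_zero, mul_zero]
  · simp

/-- The Lie derivative of the constant multivector field along `X` is the action of `-dX`. -/
lemma lieDeriv_constantNambu (X : VField O n) :
    lieDeriv D X (constantNambu O hqn) = -linAct (fun k => grad D (X k)) (constantNambu O hqn) := by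
  have h1 : constantNambu O hqn ∈ integralSpan (Pi.basisFun O (Fin n)) := by
    have := ιMulti_mem_integralSpan (R := O) (Pi.basisFun O (Fin n)) (Fin.castLE hqn)
    have h : Pi.basisFun O (Fin n) ∘ Fin.castLE hqn = fun i => pd O (Fin.castLE hqn i) :=
      funext fun i => basisFun_eq_pd _
    rwa [h] at this
  have h2 : ∀ i, ι O (fun k => D i (X k)) = ∑ k, D i (X k) • ι O (pd O k) := fun i => by
    have h : (fun k => D i (X k)) = ∑ k, D i (X k) • pd O k := by
      ext l
      simp [Pi.single_apply]
    conv_lhs => rw [h]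
    rw [map_sum]
    simp only [map_smul]
  have h3 : ∀ k, interior (grad D (X k)) (constantNambu O hqn) =
      ∑ i, D i (X k) • interior (dx O i) (constantNambu O hqn) := fun k => by
    simp [grad, interior]
  rw [linAct_apply, lieDeriv]
  simp only [multiVecBasis, coeffDeriv_eq_zero _ _ h1, smul_zero, zero_sub, h2, h3,
    Finset.sum_neg_distrib, Finset.sum_mul, Finset.mul_sum, smul_mul_assoc, mul_smul_comm]
  rw [Finset.sum_comm]
  rfl

/-- Closed families of functions along the first `m` coordinates have a potential. -/
lemma exists_potential (hD : ∀ i j f, D i (D j f) = D j (D i f))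
    (hprim : ∀ i h, ∃ H, D i H = h ∧ ∀ j, j ≠ i → D j h = 0 → D j H = 0) {m : ℕ} (hm : m ≤ n)
    (g : Fin n → O)
    (hg : ∀ i j : Fin n, (i : ℕ) < m → (j : ℕ) < m → D i (g j) = D j (g i)) :
    ∃ X : O, ∀ i : Fin n, (i : ℕ) < m → D i X = g i := by
  induction m with
  | zero => exact ⟨0, fun i hi => by omega⟩
  | succ m ih =>
    obtain ⟨X, hX⟩ := ih (by omega) fun i j hi hj => hg i j (by omega) (by omega)
    let k : Fin n := ⟨m, by omega⟩
    -- By closedness the defect `g k - D k X` is constant along the earlier coordinates, hence so is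
    -- its primitive, and the equations already solved are not disturbed.
    obtain ⟨H, hH, hH'⟩ := hprim k (g k - D k X)
    refine ⟨X + H, fun i hi => ?_⟩
    rw [map_add]
    rcases Nat.lt_or_ge (i : ℕ) m with h | h
    · rw [hX i h, hH' i, add_zero]
      · rintro rfl
        simp [k] at h
      · rw [map_sub, hD i k, hX i h, hg i k hi (by simp [k]), sub_self]
    · obtain rfl : i = k := Fin.ext (by simp [k]; omega)
      rw [hH]
      ring

variable {D}

/-- Symmetric second derivatives are paired with antisymmetric products `dx_l ∧ dx_i`, so the double
sum equals its own negative. What remains is the differential of the divergence of `X`. -/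
lemma extDer_contract_linAct_grad [IsAddTorsionFree O] (hD : ∀ i j f, D i (D j f) = D j (D i f))
    (X : VField O n) :
    extDer D (contractMulti O n (linAct (fun k => grad D (X k)) (constantNambu O hqn))
      (stdVolume O n)) = ι O (grad D (linTrace fun k => grad D (X k))) * constantForm hqn := by
  rw [extDer_contract_linAct, sub_eq_self]
  refine Finset.sum_eq_zero fun k _ => ?_
  generalize interiorVec (pd O k) (constantForm hqn) = y
  simp only [grad_pd, ι_grad_mul]
  have h : ∑ i, ∑ l, D l (D i (X k)) • (ι O (dx O l) * (ι O (dx O i) * y)) =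
      -∑ i, ∑ l, D l (D i (X k)) • (ι O (dx O l) * (ι O (dx O i) * y)) := by
    conv_lhs => rw [Finset.sum_comm]
    rw [← Finset.sum_neg_distrib]
    refine Finset.sum_congr rfl fun i _ => ?_
    rw [← Finset.sum_neg_distrib]
    refine Finset.sum_congr rfl fun l _ => ?_
    rw [hD i l, ι_mul_ι_mul_comm, smul_neg]
  refine smul_eq_zero_of_forall_smul (Pi.basisFun O (Fin n)).dualBasis (c := ((2 : ℕ) : O))
    (fun r hr => ?_) ?_
  · rw [← nsmul_eq_mul] at hr
    exact (nsmul_eq_zero_iff_right (by omega)).1 hr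
  · rw [Nat.cast_smul_eq_nsmul, two_nsmul]
    nth_rewrite 2 [h]
    exact add_neg_cancel _

/-- The differential conditions do not depend on the choice of the volume form. -/
lemma smul_deformation_iff (u : Oˣ) {ω η : DForm O n} (hω : extDer D ω = 0) (A : MultiVec O n)
    (h : ω * contractMulti O n A η + η * contractMulti O n A ω = 0) :
    extDer D ((u : O) • ω) * contractMulti O n A ((u : O) • η) +
        extDer D ((u : O) • η) * contractMulti O n A ((u : O) • ω) = 0 ↔
      extDer D η * contractMulti O n A ω = 0 := by
  -- Because `ω` is closed, the terms with `du` assemble to `du` wedged with the first condition.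
  have h1 : extDer D ((u : O) • ω) * contractMulti O n A ((u : O) • η) +
        extDer D ((u : O) • η) * contractMulti O n A ((u : O) • ω) =
      (u : O) • (ι O (grad D (u : O)) *
        (ω * contractMulti O n A η + η * contractMulti O n A ω)) +
      (u * u : O) • (extDer D η * contractMulti O n A ω) := by
    simp only [extDer_smul_function, hω, map_smul, smul_zero, add_zero, add_mul, mul_add, smul_add,
      smul_mul_assoc, mul_smul_comm, mul_assoc, smul_smul]
    abel
  rw [h1, h, mul_zero, smul_zero, zero_add]
  constructor
  · intro h2
    have h3 := congrArg (fun y => ((u⁻¹ * u⁻¹ : Oˣ) : O) • y) h2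
    simpa [smul_smul, mul_assoc] using h3
  · intro h2
    rw [h2, smul_zero]

lemma smul_decomposable_iff (u : Oˣ) (ω η : DForm O n) (A : MultiVec O n) :
    (u : O) • ω * contractMulti O n A ((u : O) • η) +
        (u : O) • η * contractMulti O n A ((u : O) • ω) = 0 ↔
      ω * contractMulti O n A η + η * contractMulti O n A ω = 0 := by
  have h1 : (u : O) • ω * contractMulti O n A ((u : O) • η) +
        (u : O) • η * contractMulti O n A ((u : O) • ω) =
      (u * u : O) • (ω * contractMulti O n A η + η * contractMulti O n A ω) := by
    simp only [map_smul, smul_mul_assoc, mul_smul_comm, smul_smul, smul_add]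
  rw [h1]
  constructor
  · intro h2
    have h3 := congrArg (fun y => ((u⁻¹ * u⁻¹ : Oˣ) : O) • y) h2
    rw [smul_smul] at h3
    simpa [mul_assoc] using h3
  · intro h2
    rw [h2, smul_zero]

lemma extDer_constantForm : extDer D (constantForm hqn) = 0 :=
  extDer_integral D (constantForm_mem_integralSpan hqn)

lemma isNambu_constantNambu (u : Oˣ) :
    IsNambu D ((u : O) • stdVolume O n) q (constantNambu O hqn) := by
  refine ⟨constantNambu_mem hqn, ?_, fun s hs A hA => ?_⟩
  · rw [map_smul]
    exact Submodule.smul_mem _ _ (constantForm_mem hqn)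
  · have h := constantForm_mul_contract hqn hs hA
    rw [map_smul, extDer_smul_function, extDer_constantForm, smul_zero, add_zero, map_smul,
      smul_mul_assoc, mul_smul_comm, mul_smul_comm, mul_assoc, h]
    simp

/-- Membership in `Z(Λ)` in terms of the standard volume form. -/
lemma mem_infinitesimalDeformations_iff (u : Oˣ) {P : MultiVec O n} :
    P ∈ infinitesimalDeformations D ((u : O) • stdVolume O n) q (constantNambu O hqn) ↔
      P ∈ ⋀[O]^q (VField O n) ∧ ∀ s : ℕ, s + 1 = n - q → ∀ A ∈ ⋀[O]^s (VField O n),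
        constantForm hqn * contractMulti O n A (contractMulti O n P (stdVolume O n)) +
          contractMulti O n P (stdVolume O n) * contractMulti O n A (constantForm hqn) = 0 ∧
        extDer D (contractMulti O n P (stdVolume O n)) *
          contractMulti O n A (constantForm hqn) = 0 := by
  change (_ ∧ _ ∧ _) ↔ _
  rw [map_smul, map_smul]
  refine and_congr_right fun hP => ?_
  constructor
  · rintro ⟨-, h⟩ s hs A hA
    have h1 := (smul_decomposable_iff u _ _ A).1 (h s hs A hA).1
    exact ⟨h1, (smul_deformation_iff u (extDer_constantForm hqn) A h1).1 (h s hs A hA).2⟩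
  · intro h
    refine ⟨Submodule.smul_mem _ _ (contract_stdVolume_mem hqn hP), fun s hs A hA => ?_⟩
    obtain ⟨h1, h2⟩ := h s hs A hA
    exact ⟨(smul_decomposable_iff u _ _ A).2 h1,
      (smul_deformation_iff u (extDer_constantForm hqn) A h1).2 h2⟩

/-- The first condition holds along any linear action. For the second, the exterior derivative is a
multiple of `ω`, and `ω ∧ i_A ω = 0`. -/
lemma trivialDeformations_le [IsAddTorsionFree O] (hD : ∀ i j f, D i (D j f) = D j (D i f))
    (u : Oˣ) : trivialDeformations D (constantNambu O hqn) ≤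
      infinitesimalDeformations D ((u : O) • stdVolume O n) q (constantNambu O hqn) := by
  rintro _ ⟨X, rfl⟩
  rw [lieDeriv_constantNambu]
  refine neg_mem ((mem_infinitesimalDeformations_iff hqn u).2
    ⟨linAct_mem _ (constantNambu_mem hqn), fun s hs A hA =>
      ⟨linAct_constantNambu_decomposable hqn _ hs hA, ?_⟩⟩)
  rw [extDer_contract_linAct_grad hqn hD, mul_assoc, constantForm_mul_contract hqn hs hA, mul_zero]

/-- Rescaling one leaf vector by `f` rescales `Λ`, so multiples of `Λ` need no separate treatment.
-/
lemma linAct_single_constantNambu (hq : 1 ≤ q) (f : O) :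
    linAct (Pi.single ⟨0, by omega⟩ (f • dx O ⟨0, by omega⟩)) (constantNambu O hqn) =
      f • constantNambu O hqn := by
  rw [linAct_apply, Finset.sum_eq_single ⟨0, by omega⟩]
  · rw [Pi.single_eq_same, pd_mul_interior_constantNambu hqn _ (by simp; omega)]
    simp [dx_pd]
  · intro k _ hk
    rw [Pi.single_eq_of_ne hk]
    simp
  · simp

/-- An off-diagonal leaf entry replaces a factor of `Λ` by another factor already present, and
entries on transversal vectors are never evaluated. -/
lemma linAct_constantNambu_congr {α β : Fin n → Module.Dual O (VField O n)}
    (h : ∀ k : Fin n, (k : ℕ) < q → α k (pd O k) = β k (pd O k))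
    (h' : ∀ k i : Fin n, q ≤ (k : ℕ) → (i : ℕ) < q → α k (pd O i) = β k (pd O i)) :
    linAct α (constantNambu O hqn) = linAct β (constantNambu O hqn) := by
  rw [linAct_apply, linAct_apply]
  refine Finset.sum_congr rfl fun k _ => ?_
  rcases Nat.lt_or_ge (k : ℕ) q with hk | hk
  · rw [pd_mul_interior_constantNambu hqn _ hk, pd_mul_interior_constantNambu hqn _ hk, h k hk]
  · have h1 : interior (α k - β k) (constantNambu O hqn) = 0 :=
      interior_constantNambu hqn fun i hi => by rw [LinearMap.sub_apply, h' k i hk hi, sub_self]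
    rw [interior, map_sub, LinearMap.sub_apply, sub_eq_zero] at h1
    rw [h1]

/-- Every infinitesimal deformation of the constant Nambu structure is trivial. -/
lemma infinitesimalDeformations_le [IsAddTorsionFree O] (hq : 1 ≤ q)
    (hD : ∀ i j f, D i (D j f) = D j (D i f))
    (hprim : ∀ i h, ∃ H, D i H = h ∧ ∀ j, j ≠ i → D j h = 0 → D j H = 0) (u : Oˣ) :
    infinitesimalDeformations D ((u : O) • stdVolume O n) q (constantNambu O hqn) ≤
      trivialDeformations D (constantNambu O hqn) := by
  intro P hP
  obtain ⟨hPq, hP⟩ := (mem_infinitesimalDeformations_iff hqn u).1 hP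
  obtain ⟨f, α, hPα⟩ := exists_linAct_constantNambu hqn hq hPq fun j k hj hk =>
    interior_interior_eq_zero_of_decomposable hqn hPq (fun s hs A hA => (hP s hs A hA).1) hj hk
  rw [← linAct_single_constantNambu hqn hq f, ← linAct_add] at hPα
  generalize Pi.single _ _ + α = β at hPα
  -- The required equations decouple over the components of the vector field: one equation for a
  -- leaf index, a closed system along the leaves for a transversal one.
  have hpot : ∀ k : Fin n, ∃ X : O, ((k : ℕ) < q → D k X = -β k (pd O k)) ∧
      (q ≤ (k : ℕ) → ∀ i : Fin n, (i : ℕ) < q → D i X = -β k (pd O i)) := by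
    intro k
    rcases Nat.lt_or_ge (k : ℕ) q with hk | hk
    · obtain ⟨X, hX, -⟩ := hprim k (-β k (pd O k))
      exact ⟨X, fun _ => hX, fun h => by omega⟩
    · suffices h : ∃ X : O, ∀ i : Fin n, (i : ℕ) < q → D i X = -β k (pd O i) by
        obtain ⟨X, hX⟩ := h
        exact ⟨X, fun h => by omega, fun _ => hX⟩
      refine exists_potential D hD hprim hqn _ fun i j hi hj => ?_
      obtain ⟨s, hs⟩ : ∃ s, s + 1 = n - q := ⟨n - q - 1, by omega⟩
      obtain ⟨A, hA, c, hc, hAc⟩ := exists_contract_constantForm (O := O) hqn hs hk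
      have h1 := (hP s hs A hA).2
      rw [hAc, mul_smul_comm] at h1
      have h2 := smul_eq_zero_of_forall_smul (Pi.basisFun O (Fin n)).dualBasis hc h1
      rw [hPα, extDer_contract_linAct_mul_dx hqn D _ hs hk] at h2
      have h3 := congrArg (fun y => -(-1 : O) ^ s • y) h2
      simp only [smul_smul, smul_zero, neg_mul_neg, ← mul_pow, mul_one, one_pow, one_smul] at h3
      have h4 := symm_of_sum_dx_dx_constantForm hqn h3 hi hj
      rw [map_neg, map_neg, h4]
  choose X hX hX' using hpot
  have h : linAct β (constantNambu O hqn) =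
      linAct (fun k => grad D (-X k)) (constantNambu O hqn) := by
    refine linAct_constantNambu_congr hqn (fun k hk => ?_) fun k i hk hi => ?_
    · rw [grad_pd, map_neg, hX k hk, neg_neg]
    · rw [grad_pd, map_neg, hX' k hk i hi, neg_neg]
  have h1 := lieDeriv_constantNambu hqn D (-X)
  simp only [Pi.neg_apply] at h1
  rw [hPα, h]
  -- The Lie derivative along `-X` is `-P`, so membership is shown for `-P`.
  refine neg_mem_iff.1 ⟨-X, ?_⟩
  rw [h1]

/-- Rigidity of the constant Nambu structure over a ring of functions with commuting partial
derivatives which admit primitives. -/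
theorem constantNambu_rigid [CharZero 𝕜] (hq : 1 ≤ q)
    (hD : ∀ i j f, D i (D j f) = D j (D i f))
    (hprim : ∀ i h, ∃ H, D i H = h ∧ ∀ j, j ≠ i → D j h = 0 → D j H = 0)
    {Ω : DForm O n} (hΩ : IsVolumeForm Ω) :
    IsNambu D Ω q (constantNambu O hqn) ∧
      trivialDeformations D (constantNambu O hqn) ≤
        infinitesimalDeformations D Ω q (constantNambu O hqn) ∧
      Subsingleton (DH D Ω q (constantNambu O hqn)) := by
  have : IsAddTorsionFree O := by
    have : Module ℚ 𝕜 := inferInstance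
    have : Module ℚ O := Module.compHom O (algebraMap ℚ 𝕜)
    exact IsAddTorsionFree.of_module_rat O
  obtain ⟨u, rfl⟩ := hΩ
  refine ⟨isNambu_constantNambu hqn u, trivialDeformations_le hqn hD u, ?_⟩
  rw [Submodule.Quotient.subsingleton_iff, Submodule.submoduleOf,
    Submodule.comap_subtype_eq_top]
  exact infinitesimalDeformations_le hqn hq hD hprim u

end Deformations

/-! ### Primitives of formal power series. -/

section Formal

variable {𝕜 : Type*} [Field 𝕜] {n : ℕ}

open MvPowerSeries in
lemma pderiv_comm (i j : Fin n) (f : MvPowerSeries (Fin n) 𝕜) :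
    pderiv 𝕜 i (pderiv 𝕜 j f) = pderiv 𝕜 j (pderiv 𝕜 i f) := by
  by_cases h : i = j
  · rw [h]
  ext m
  simp only [coeff_pderiv, Finsupp.add_apply, Finsupp.single_apply, if_neg h, if_neg (Ne.symm h),
    add_zero]
  rw [add_right_comm]
  ring

open MvPowerSeries in
-- Integrate term by term. The case `m i = 0` sets the integration constant to zero and also
-- protects the truncated subtraction; shifting the exponent of `x_i` does not affect that of `x_j`.
lemma exists_primitive_formal [CharZero 𝕜] (i : Fin n) (h : MvPowerSeries (Fin n) 𝕜) :
    ∃ H, pderiv 𝕜 i H = h ∧ ∀ j, j ≠ i → pderiv 𝕜 j h = 0 → pderiv 𝕜 j H = 0 := by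
  let H : MvPowerSeries (Fin n) 𝕜 := fun m =>
    if m i = 0 then 0 else coeff (m - Finsupp.single i 1) h / (m i : 𝕜)
  have hH : ∀ m, coeff m H =
      if m i = 0 then 0 else coeff (m - Finsupp.single i 1) h / (m i : 𝕜) := fun m => rfl
  refine ⟨H, ?_, fun j hj h0 => ?_⟩
  · ext m
    have h1 : ((m i : 𝕜) + 1) ≠ 0 := by exact_mod_cast Nat.succ_ne_zero (m i)
    rw [coeff_pderiv, hH]
    simp only [Finsupp.add_apply, Finsupp.single_eq_same, Nat.add_eq_zero_iff, one_ne_zero,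
      and_false, if_false, add_tsub_cancel_right, Nat.cast_add, Nat.cast_one]
    exact div_mul_cancel₀ _ h1
  · ext m
    rw [coeff_pderiv, hH, map_zero]
    have h2 : (m + Finsupp.single j 1 : Fin n →₀ ℕ) i = m i := by
      simp [Finsupp.single_eq_of_ne hj.symm]
    rw [h2]
    split_ifs with h3
    · rw [zero_mul]
    · have h4 := congrArg (coeff (m - Finsupp.single i 1)) h0
      rw [coeff_pderiv, map_zero] at h4
      have h5 : m - Finsupp.single i 1 + Finsupp.single j 1 =
          m + Finsupp.single j 1 - Finsupp.single i 1 := by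
        refine tsub_add_eq_add_tsub ?_
        rw [Finsupp.single_le_iff]
        omega
      have h6 : (m - Finsupp.single i 1 : Fin n →₀ ℕ) j = m j := by
        simp [Finsupp.single_eq_of_ne hj]
      rw [h5, h6] at h4
      rw [div_mul_eq_mul_div, h4, zero_div]

end Formal

/-! ### Integrals of power series and scaling of one coordinate. -/

section ParametricIntegral

open MeasureTheory

/-- The integral of a family of power series with a common summable bound is a power series. -/
lemma hasFPowerSeriesOnBall_integral {𝕜 E F α : Type*} [RCLike 𝕜] [NormedAddCommGroup E]
    [NormedSpace 𝕜 E] [NormedAddCommGroup F] [NormedSpace 𝕜 F] [NormedSpace ℝ F]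
    [SMulCommClass 𝕜 ℝ F] [CompleteSpace F] [MeasurableSpace α] {μ : Measure α} [IsFiniteMeasure μ]
    {f : α → E → F} {q : α → FormalMultilinearSeries 𝕜 E F} {B : ℕ → ℝ} {ρ : NNReal} {x₀ : E}
    (hρ : 0 < ρ) (hB : Summable B) (hq : ∀ᵐ t ∂μ, ∀ m, ‖q t m‖ * (ρ : ℝ) ^ m ≤ B m)
    (hmeas : ∀ m, AEStronglyMeasurable (fun t => q t m) μ)
    (hsum : ∀ᵐ t ∂μ, ∀ y, ‖y‖ < ρ → HasSum (fun m => q t m fun _ => y) (f t (x₀ + y))) :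
    HasFPowerSeriesOnBall (fun x => ∫ t, f t x ∂μ) (fun m => ∫ t, q t m ∂μ) x₀ ρ := by
  have hρ' : (0 : ℝ) < ρ := hρ
  have hq' : ∀ m, ∀ᵐ t ∂μ, ‖q t m‖ ≤ B m / (ρ : ℝ) ^ m := fun m => by
    filter_upwards [hq] with t ht
    rw [le_div_iff₀ (pow_pos hρ' m)]
    exact ht m
  have hint : ∀ m, Integrable (fun t => q t m) μ := fun m =>
    Integrable.of_bound (hmeas m) _ (hq' m)
  refine ⟨?_, by exact_mod_cast hρ, ?_⟩
  · obtain ⟨C, hC⟩ := hB.tendsto_atTop_zero.bddAbove_range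
    refine FormalMultilinearSeries.le_radius_of_bound _ (C * μ.real Set.univ) fun m => ?_
    have h1 : ‖∫ t, q t m ∂μ‖ ≤ B m / (ρ : ℝ) ^ m * μ.real Set.univ :=
      norm_integral_le_of_norm_le_const (hq' m)
    calc ‖∫ t, q t m ∂μ‖ * (ρ : ℝ) ^ m ≤ B m / (ρ : ℝ) ^ m * μ.real Set.univ * (ρ : ℝ) ^ m := by
          gcongr
      _ = B m * μ.real Set.univ := by field_simp
      _ ≤ C * μ.real Set.univ := by
          gcongr
          exact hC ⟨m, rfl⟩
  · intro y hy
    have hy' : ‖y‖ < ρ := by simpa using hy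
    have hbound : ∀ m, ∀ᵐ t ∂μ, ‖q t m fun _ => y‖ ≤ B m := fun m => by
      filter_upwards [hq] with t ht
      refine ((q t m).le_opNorm _).trans (le_trans ?_ (ht m))
      rw [Finset.prod_const, Finset.card_univ, Fintype.card_fin]
      gcongr
    have happ : ∀ m, (∫ t, q t m ∂μ) (fun _ => y) = ∫ t, q t m (fun _ => y) ∂μ := fun m =>
      ((ContinuousMultilinearMap.apply 𝕜 (fun _ : Fin m => E) F fun _ => y).integral_comp_comm
        (hint m)).symm
    have hint' : ∀ m, Integrable (fun t => q t m fun _ => y) μ := fun m =>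
      (ContinuousMultilinearMap.apply 𝕜 (fun _ : Fin m => E) F fun _ => y).integrable_comp (hint m)
    -- Sum and integral are exchanged using the majorant `B m` times the total mass.
    have h1 : HasSum (fun m => ∫ t, q t m (fun _ => y) ∂μ)
        (∫ t, ∑' m, q t m (fun _ => y) ∂μ) := by
      refine hasSum_integral_of_summable_integral_norm hint' ?_
      refine Summable.of_nonneg_of_le (fun m => integral_nonneg fun t => norm_nonneg _) (fun m => ?_)
        (hB.mul_right (μ.real Set.univ))
      have := norm_integral_le_of_norm_le_const (f := fun t => ‖q t m fun _ => y‖) (μ := μ)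
        (C := B m) (by simpa using hbound m)
      exact (le_abs_self _).trans this
    have h2 : ∫ t, ∑' m, q t m (fun _ => y) ∂μ = ∫ t, f t (x₀ + y) ∂μ := by
      refine integral_congr_ae ?_
      filter_upwards [hsum] with t ht
      exact (ht y hy').tsum_eq
    rw [h2] at h1
    simpa only [happ] using h1

variable {𝕜 : Type*} [RCLike 𝕜] {n : ℕ}

/-- Multiplication of the `i`-th coordinate by `t`. -/
noncomputable def scaleCoord (𝕜 : Type*) [RCLike 𝕜] {n : ℕ} (i : Fin n) (t : ℝ) :
    (Fin n → 𝕜) →L[𝕜] (Fin n → 𝕜) :=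
  ContinuousLinearMap.id 𝕜 _ +
    ((t : 𝕜) - 1) • (ContinuousLinearMap.proj i).smulRight (Pi.single i (1 : 𝕜))

lemma scaleCoord_apply (i : Fin n) (t : ℝ) (x : Fin n → 𝕜) :
    scaleCoord 𝕜 i t x = x + (((t : 𝕜) - 1) * x i) • Pi.single i (1 : 𝕜) := by
  simp [scaleCoord, smul_smul]

lemma scaleCoord_one (i : Fin n) (x : Fin n → 𝕜) : scaleCoord 𝕜 i 1 x = x := by
  simp [scaleCoord_apply]

lemma norm_scaleCoord_apply_le (i : Fin n) {t : ℝ} (ht : t ∈ Set.Icc (0 : ℝ) 1) (x : Fin n → 𝕜) :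
    ‖scaleCoord 𝕜 i t x‖ ≤ ‖x‖ := by
  rw [pi_norm_le_iff_of_nonneg (norm_nonneg x)]
  intro j
  rw [scaleCoord_apply]
  by_cases h : j = i
  · subst h
    have h1 : (x + (((t : 𝕜) - 1) * x j) • (Pi.single j (1 : 𝕜) : Fin n → 𝕜)) j = t * x j := by
      simp
      ring
    rw [h1, norm_mul, RCLike.norm_ofReal, abs_of_nonneg ht.1]
    exact (mul_le_of_le_one_left (norm_nonneg _) ht.2).trans (norm_le_pi_norm x j)
  · simpa [h] using norm_le_pi_norm x j

lemma norm_scaleCoord_le (i : Fin n) {t : ℝ} (ht : t ∈ Set.Icc (0 : ℝ) 1) :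
    ‖scaleCoord 𝕜 i t‖ ≤ 1 :=
  ContinuousLinearMap.opNorm_le_bound _ zero_le_one fun x => by
    rw [one_mul]
    exact norm_scaleCoord_apply_le i ht x

lemma continuous_scaleCoord (i : Fin n) : Continuous (scaleCoord 𝕜 i) := by
  unfold scaleCoord
  have h : Continuous fun t : ℝ => (t : 𝕜) := RCLike.continuous_ofReal
  fun_prop

lemma continuous_scaleCoord_apply (i : Fin n) :
    Continuous fun p : ℝ × (Fin n → 𝕜) => scaleCoord 𝕜 i p.1 p.2 :=
  ((continuous_scaleCoord i).comp continuous_fst).clm_apply continuous_snd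

end ParametricIntegral

/-! ### Analyticity of the mean over a scaled segment. -/

section ScaledIntegral

open MeasureTheory Set

variable {𝕜 : Type*} [RCLike 𝕜] {n : ℕ}

/-- Weighted mean of `h` over the segment obtained by scaling the `i`-th coordinate. -/
noncomputable def scaledMean (i : Fin n) (φ : ℝ → 𝕜) (h : (Fin n → 𝕜) → 𝕜) (x : Fin n → 𝕜) : 𝕜 :=
  ∫ t in (0 : ℝ)..1, φ t * h (scaleCoord 𝕜 i t x)

/-- The expansion of `h` at the point scaled by `t₀` is recentred at the points scaled by nearby `t`
and composed with the scaling. This gives power series at the single point `x₀` with a majorant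
uniform in `t`, which can be integrated. -/
lemma exists_delta_analyticAt_integral (i : Fin n) {h : (Fin n → 𝕜) → 𝕜} {x₀ : Fin n → 𝕜} {t₀ : ℝ}
    (hh : AnalyticAt 𝕜 h (scaleCoord 𝕜 i t₀ x₀)) :
    ∃ V : Set ℝ, IsOpen V ∧ t₀ ∈ V ∧ ∀ a b : ℝ, a ≤ b → Icc a b ⊆ V → Icc a b ⊆ Icc 0 1 →
      AnalyticAt 𝕜 (fun x => ∫ t in a..b, h (scaleCoord 𝕜 i t x)) x₀ := by
  obtain ⟨P, r, hP⟩ := hh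
  -- One `ρ` is spent on moving the centre; the other is the radius left for the recentred series.
  obtain ⟨ρ, hρ, hρr⟩ : ∃ ρ : NNReal, 0 < ρ ∧ (ρ + ρ : ENNReal) < r := by
    obtain ⟨σ, hσ, hσr⟩ := ENNReal.lt_iff_exists_nnreal_btwn.1 hP.r_pos
    refine ⟨σ / 2, half_pos (by exact_mod_cast hσ), ?_⟩
    rw [← ENNReal.coe_add, add_halves]
    exact hσr
  set c := scaleCoord 𝕜 i t₀ x₀ with hc
  have hcont : Continuous fun t : ℝ => scaleCoord 𝕜 i t x₀ - c :=
    ((continuous_scaleCoord i).clm_apply continuous_const).sub continuous_const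
  refine ⟨{t | ‖scaleCoord 𝕜 i t x₀ - c‖ < ρ}, isOpen_lt hcont.norm continuous_const, by
    simpa [hc] using hρ, fun a b hab hV h01 => ?_⟩
  have hV' : ∀ t ∈ Ioc a b, ‖scaleCoord 𝕜 i t x₀ - c‖ < ρ := fun t ht => hV (Ioc_subset_Icc_self ht)
  have h01' : ∀ t ∈ Ioc a b, t ∈ Icc (0 : ℝ) 1 := fun t ht => h01 (Ioc_subset_Icc_self ht)
  have hrad : (ρ + ρ : ENNReal) < P.radius := hρr.trans_le hP.r_le
  have hsumm := NNReal.summable_sigma.1 (P.changeOriginSeries_summable_aux₁ hrad)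
  let q : ℝ → FormalMultilinearSeries 𝕜 (Fin n → 𝕜) 𝕜 := fun t m =>
    (P.changeOrigin (scaleCoord 𝕜 i t x₀ - c) m).compContinuousLinearMap fun _ => scaleCoord 𝕜 i t
  -- These are the partial sums, over fixed `m`, of the double series that controls recentring; its
  -- convergence inside the radius makes `B` summable.
  let B : ℕ → NNReal := fun m =>
    ∑' s : Σ l : ℕ, { s : Finset (Fin (m + l)) // s.card = l }, ‖P (m + s.1)‖₊ * ρ ^ s.1 * ρ ^ m
  have hB : Summable fun m => (B m : ℝ) := NNReal.summable_coe.2 hsumm.2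
  have hqB : ∀ t ∈ Ioc a b, ∀ m, ‖q t m‖ * (ρ : ℝ) ^ m ≤ B m := by
    intro t ht m
    have h1 : ‖q t m‖ ≤ ‖P.changeOrigin (scaleCoord 𝕜 i t x₀ - c) m‖ := by
      refine (ContinuousMultilinearMap.norm_compContinuousLinearMap_le _ _).trans ?_
      refine mul_le_of_le_one_right (norm_nonneg _) (Finset.prod_le_one (fun _ _ => norm_nonneg _)
        fun _ _ => norm_scaleCoord_le i (h01' t ht))
    have hy : ‖scaleCoord 𝕜 i t x₀ - c‖₊ ≤ ρ := (hV' t ht).le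
    have hy' : ((‖scaleCoord 𝕜 i t x₀ - c‖₊ : NNReal) : ENNReal) < P.radius :=
      lt_of_le_of_lt (by exact_mod_cast hy) (lt_of_le_of_lt le_self_add hrad)
    have hsm : Summable fun s : Σ l : ℕ, { s : Finset (Fin (m + l)) // s.card = l } =>
        ‖P (m + s.1)‖₊ * ρ ^ s.1 :=
      P.changeOriginSeries_summable_aux₂ (lt_of_le_of_lt le_self_add hrad) m
    have h2 : ‖P.changeOrigin (scaleCoord 𝕜 i t x₀ - c) m‖₊ * ρ ^ m ≤ B m := by
      simp only [B]
      rw [NNReal.tsum_mul_right]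
      gcongr
      refine (P.nnnorm_changeOrigin_le m hy').trans ?_
      refine Summable.tsum_le_tsum (fun s => ?_)
        (P.changeOriginSeries_summable_aux₂ hy' m) hsm
      gcongr
    calc ‖q t m‖ * (ρ : ℝ) ^ m
        ≤ ‖P.changeOrigin (scaleCoord 𝕜 i t x₀ - c) m‖ * (ρ : ℝ) ^ m := by gcongr
      _ ≤ B m := by exact_mod_cast h2
  have hqc : ∀ m, ContinuousOn (fun t => q t m) (Ioc a b) := by
    intro m
    have h1 : ContinuousOn (fun y => P.changeOrigin y m) (Metric.eball 0 P.radius) :=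
      (P.hasFPowerSeriesOnBall_changeOrigin m (lt_of_le_of_lt (zero_le) hrad)).continuousOn
    have h2 : ContinuousOn (fun t => P.changeOrigin (scaleCoord 𝕜 i t x₀ - c) m) (Ioc a b) := by
      refine h1.comp hcont.continuousOn fun t ht => ?_
      rw [mem_eball_zero_iff]
      refine lt_of_le_of_lt ?_ (lt_of_le_of_lt le_self_add hrad)
      have hy : ‖scaleCoord 𝕜 i t x₀ - c‖₊ ≤ ρ := (hV' t ht).le
      exact_mod_cast hy
    have h3 : Continuous fun t =>
        ContinuousMultilinearMap.compContinuousLinearMapContinuousMultilinear 𝕜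
          (fun _ : Fin m => Fin n → 𝕜) (fun _ : Fin m => Fin n → 𝕜) 𝕜
          (fun _ => scaleCoord 𝕜 i t) :=
      (ContinuousMultilinearMap.cont _).comp (continuous_pi fun _ => continuous_scaleCoord i)
    exact h3.continuousOn.clm_apply h2
  have key := hasFPowerSeriesOnBall_integral (μ := volume.restrict (Ioc a b))
    (f := fun t x => h (scaleCoord 𝕜 i t x)) (q := q) (x₀ := x₀) hρ hB
    ((ae_restrict_iff' measurableSet_Ioc).2 (Filter.Eventually.of_forall hqB))
    (fun m => (hqc m).aestronglyMeasurable measurableSet_Ioc)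
    ((ae_restrict_iff' measurableSet_Ioc).2 (Filter.Eventually.of_forall fun t ht y hy => by
      have hyt : ‖scaleCoord 𝕜 i t x₀ - c‖ₑ < ρ := by
        have := hV' t ht
        rw [← ofReal_norm]
        exact (ENNReal.ofReal_lt_ofReal_iff hρ).2 this |>.trans_eq (ENNReal.ofReal_coe_nnreal)
      have h1 := hP.changeOrigin (y := scaleCoord 𝕜 i t x₀ - c)
        (hyt.trans_le (le_trans le_self_add hρr.le))
      have h2 : scaleCoord 𝕜 i t y ∈
          Metric.eball (0 : Fin n → 𝕜) (r - ‖scaleCoord 𝕜 i t x₀ - c‖ₑ) := by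
        rw [mem_eball_zero_iff, lt_tsub_iff_right]
        refine lt_of_le_of_lt (add_le_add ?_ hyt.le) hρr
        have h3 := (norm_scaleCoord_apply_le i (h01' t ht) y).trans hy.le
        rw [← ofReal_norm]
        exact (ENNReal.ofReal_le_ofReal h3).trans_eq ENNReal.ofReal_coe_nnreal
      have h3 := h1.hasSum h2
      rw [add_sub_cancel, ← map_add] at h3
      exact h3))
  have h4 : (fun x => ∫ t in a..b, h (scaleCoord 𝕜 i t x)) =
      fun x => ∫ t in Ioc a b, h (scaleCoord 𝕜 i t x) :=
    funext fun x => intervalIntegral.integral_of_le hab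
  rw [h4]
  exact key.analyticAt

/-- By compactness of the unit interval, a finite subdivision reduces the mean to a sum of integrals
over pieces on which the local result applies. -/
lemma analyticAt_scaledMean_one (i : Fin n) {h : (Fin n → 𝕜) → 𝕜} {U : Set (Fin n → 𝕜)}
    (hU : IsOpen U) (hUi : ∀ x ∈ U, ∀ t ∈ Icc (0 : ℝ) 1, scaleCoord 𝕜 i t x ∈ U)
    (hh : AnalyticOnNhd 𝕜 h U) {x₀ : Fin n → 𝕜} (hx₀ : x₀ ∈ U) :
    AnalyticAt 𝕜 (scaledMean i (fun _ => 1) h) x₀ := by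
  have hloc : ∀ t : Icc (0 : ℝ) 1, ∃ V : Set ℝ, IsOpen V ∧ (t : ℝ) ∈ V ∧
      ∀ a b : ℝ, a ≤ b → Icc a b ⊆ V → Icc a b ⊆ Icc 0 1 →
      AnalyticAt 𝕜 (fun x => ∫ t in a..b, h (scaleCoord 𝕜 i t x)) x₀ := fun t =>
    exists_delta_analyticAt_integral i (hh _ (hUi _ hx₀ t t.2))
  choose V hVo hV hVan using hloc
  obtain ⟨τ, hτ0, hτm, ⟨N, hN⟩, hτV⟩ := exists_monotone_Icc_subset_open_cover_unitInterval
    (c := fun t : Icc (0 : ℝ) 1 => (Subtype.val ⁻¹' V t : Set unitInterval))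
    (fun t => (hVo t).preimage continuous_subtype_val)
    (fun t _ => mem_iUnion.2 ⟨t, hV t⟩)
  have hstep : ∀ k, AnalyticAt 𝕜
      (fun x => ∫ t in (τ k : ℝ)..(τ (k + 1) : ℝ), h (scaleCoord 𝕜 i t x)) x₀ := by
    intro k
    obtain ⟨t, ht⟩ := hτV k
    have hsub : Icc (τ k : ℝ) (τ (k + 1)) ⊆ Icc 0 1 := Icc_subset_Icc (τ k).2.1 (τ (k + 1)).2.2
    refine hVan t _ _ (hτm (Nat.le_succ k)) (fun s hs => ?_) hsub
    exact ht (show (⟨s, hsub hs⟩ : unitInterval) ∈ Icc (τ k) (τ (k + 1)) from hs)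
  have hsum : AnalyticAt 𝕜 (fun x => ∑ k ∈ Finset.range N,
      ∫ t in (τ k : ℝ)..(τ (k + 1) : ℝ), h (scaleCoord 𝕜 i t x)) x₀ :=
    Finset.analyticAt_fun_sum _ fun k _ => hstep k
  refine hsum.congr ?_
  filter_upwards [hU.mem_nhds hx₀] with x hx
  have hcont : ContinuousOn (fun t => h (scaleCoord 𝕜 i t x)) (Icc 0 1) :=
    hh.continuousOn.comp ((continuous_scaleCoord i).clm_apply continuous_const).continuousOn
      fun t ht => hUi x hx t ht
  have h1 := intervalIntegral.sum_integral_adjacent_intervals (μ := volume)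
    (f := fun t => h (scaleCoord 𝕜 i t x)) (a := fun k => (τ k : ℝ)) (n := N) fun k _ =>
      (hcont.mono (by
        rw [uIcc_of_le (Subtype.coe_le_coe.2 (hτm (Nat.le_succ k)))]
        exact Icc_subset_Icc (τ k).2.1 (τ (k + 1)).2.2)).intervalIntegrable
  rw [h1, hτ0, hN N le_rfl]
  simp [scaledMean]

end ScaledIntegral

/-! ### Differentiating the scaled mean; primitives in one coordinate. -/

section Primitives

open MeasureTheory Set

variable {𝕜 : Type*} [RCLike 𝕜] {n : ℕ}

open scoped ContDiff in
lemma hasFDerivAt_scaledMean (i : Fin n) {φ : ℝ → 𝕜} (hφ : Continuous φ) {h : (Fin n → 𝕜) → 𝕜}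
    {U : Set (Fin n → 𝕜)} (hU : IsOpen U)
    (hUi : ∀ x ∈ U, ∀ t ∈ Icc (0 : ℝ) 1, scaleCoord 𝕜 i t x ∈ U)
    (hh : ContDiffOn 𝕜 1 h U) {x₀ : Fin n → 𝕜} (hx₀ : x₀ ∈ U) :
    HasFDerivAt (scaledMean i φ h) (∫ t in (0 : ℝ)..1,
      φ t • (fderiv 𝕜 h (scaleCoord 𝕜 i t x₀)).comp (scaleCoord 𝕜 i t)) x₀ := by
  have hfd : ContinuousOn (fderiv 𝕜 h) U := hh.continuousOn_fderiv_of_isOpen hU le_rfl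
  have hmaps : MapsTo (fun p : ℝ × (Fin n → 𝕜) => scaleCoord 𝕜 i p.1 p.2) (Icc 0 1 ×ˢ U) U :=
    fun p hp => hUi _ hp.2 _ hp.1
  have hG : ContinuousOn (fun p : ℝ × (Fin n → 𝕜) =>
      φ p.1 • (fderiv 𝕜 h (scaleCoord 𝕜 i p.1 p.2)).comp (scaleCoord 𝕜 i p.1)) (Icc 0 1 ×ˢ U) := by
    refine ContinuousOn.smul (hφ.comp continuous_fst).continuousOn (ContinuousOn.clm_comp ?_ ?_)
    · exact hfd.comp (continuous_scaleCoord_apply i).continuousOn hmaps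
    · exact ((continuous_scaleCoord i).comp continuous_fst).continuousOn
  have hF : ContinuousOn (fun p : ℝ × (Fin n → 𝕜) => φ p.1 * h (scaleCoord 𝕜 i p.1 p.2))
      (Icc 0 1 ×ˢ U) :=
    (hφ.comp continuous_fst).continuousOn.mul
      (hh.continuousOn.comp (continuous_scaleCoord_apply i).continuousOn hmaps)
  have hslice : ∀ x ∈ U, MapsTo (fun t : ℝ => (t, x)) (Icc 0 1) (Icc 0 1 ×ˢ U) :=
    fun x hx t ht => ⟨ht, hx⟩
  have hFx : ∀ x ∈ U, ContinuousOn (fun t => φ t * h (scaleCoord 𝕜 i t x)) (Icc 0 1) :=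
    fun x hx => hF.comp (Continuous.prodMk_left x).continuousOn (hslice x hx)
  have hGx : ∀ x ∈ U, ContinuousOn (fun t =>
      φ t • (fderiv 𝕜 h (scaleCoord 𝕜 i t x)).comp (scaleCoord 𝕜 i t)) (Icc 0 1) :=
    fun x hx => hG.comp (Continuous.prodMk_left x).continuousOn (hslice x hx)
  have hIoc : uIoc (0 : ℝ) 1 ⊆ Icc 0 1 := by
    rw [uIoc_of_le zero_le_one]
    exact Ioc_subset_Icc_self
  obtain ⟨ε, hε, hεU⟩ := Metric.nhds_basis_closedBall.mem_iff.1 (hU.mem_nhds hx₀)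
  -- The constant dominating function comes from continuity of the differentiated integrand on a
  -- compact product.
  obtain ⟨C, hC⟩ := (isCompact_Icc.prod (isCompact_closedBall x₀ ε)).exists_bound_of_continuousOn
    (hG.mono (prod_mono_right hεU))
  refine intervalIntegral.hasFDerivAt_integral_of_dominated_of_fderiv_le (bound := fun _ => C)
    (F := fun x t => φ t * h (scaleCoord 𝕜 i t x))
    (F' := fun x t => φ t • (fderiv 𝕜 h (scaleCoord 𝕜 i t x)).comp (scaleCoord 𝕜 i t))
    (Metric.closedBall_mem_nhds x₀ hε) ?_ ?_ ?_ ?_ ?_ ?_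
  · filter_upwards [hU.mem_nhds hx₀] with x hx
    exact ((hFx x hx).mono hIoc).aestronglyMeasurable measurableSet_uIoc
  · refine ContinuousOn.intervalIntegrable ?_
    rw [uIcc_of_le zero_le_one]
    exact hFx x₀ hx₀
  · exact ((hGx x₀ hx₀).mono hIoc).aestronglyMeasurable measurableSet_uIoc
  · exact Filter.Eventually.of_forall fun t ht x hx => hC (t, x) ⟨hIoc ht, hx⟩
  · exact intervalIntegrable_const
  · refine Filter.Eventually.of_forall fun t ht x hx => ?_
    have h1 : DifferentiableAt 𝕜 h (scaleCoord 𝕜 i t x) :=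
      (hh.differentiableOn one_ne_zero).differentiableAt
        (hU.mem_nhds (hUi x (hεU hx) t (hIoc ht)))
    exact (h1.hasFDerivAt.comp x (scaleCoord 𝕜 i t).hasFDerivAt).const_smul (φ t)

/-- Scaling sends `y` to `y + (t - 1) y_i e_i`. Derivatives of scaled means are thus again scaled
means, with weights `φ` and `φ(t)(t - 1)`; this is why general weights are admitted, and it makes
induction on the order of smoothness possible. -/
lemma fderiv_scaledMean_apply (i : Fin n) {φ : ℝ → 𝕜} (hφ : Continuous φ)
    {h : (Fin n → 𝕜) → 𝕜} {U : Set (Fin n → 𝕜)} (hU : IsOpen U)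
    (hUi : ∀ x ∈ U, ∀ t ∈ Icc (0 : ℝ) 1, scaleCoord 𝕜 i t x ∈ U)
    (hh : ContDiffOn 𝕜 1 h U) {x₀ : Fin n → 𝕜} (hx₀ : x₀ ∈ U) (y : Fin n → 𝕜) :
    fderiv 𝕜 (scaledMean i φ h) x₀ y = scaledMean i φ (fun x => fderiv 𝕜 h x y) x₀ +
      y i * scaledMean i (fun t => φ t * ((t : 𝕜) - 1))
        (fun x => fderiv 𝕜 h x (Pi.single i 1)) x₀ := by
  have hfd : ContinuousOn (fderiv 𝕜 h) U := hh.continuousOn_fderiv_of_isOpen hU le_rfl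
  have hc : ContinuousOn (fun t => fderiv 𝕜 h (scaleCoord 𝕜 i t x₀)) (Icc 0 1) :=
    hfd.comp ((continuous_scaleCoord i).clm_apply continuous_const).continuousOn
      fun t ht => hUi _ hx₀ t ht
  have h01 : uIcc (0 : ℝ) 1 = Icc 0 1 := uIcc_of_le zero_le_one
  have hof : Continuous fun t : ℝ => (t : 𝕜) := RCLike.continuous_ofReal
  rw [(hasFDerivAt_scaledMean i hφ hU hUi hh hx₀).fderiv]
  rw [ContinuousLinearMap.intervalIntegral_apply]
  · simp only [scaledMean]
    rw [← intervalIntegral.integral_const_mul, ← intervalIntegral.integral_add]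
    · refine intervalIntegral.integral_congr fun t _ => ?_
      simp only [smul_apply, ContinuousLinearMap.comp_apply, smul_eq_mul]
      rw [scaleCoord_apply i t y, map_add, map_smul, smul_eq_mul]
      ring
    · refine ContinuousOn.intervalIntegrable ?_
      rw [h01]
      exact hφ.continuousOn.mul (hc.clm_apply continuousOn_const)
    · refine ContinuousOn.intervalIntegrable ?_
      rw [h01]
      exact continuousOn_const.mul ((hφ.mul (hof.sub continuous_const)).continuousOn.mul
        (hc.clm_apply continuousOn_const))
  · refine ContinuousOn.intervalIntegrable ?_
    rw [h01]
    exact hφ.continuousOn.smul (hc.clm_comp (continuous_scaleCoord i).continuousOn)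

open scoped ContDiff in
lemma contDiffOn_scaledMean (i : Fin n) {U : Set (Fin n → 𝕜)} (hU : IsOpen U)
    (hUi : ∀ x ∈ U, ∀ t ∈ Icc (0 : ℝ) 1, scaleCoord 𝕜 i t x ∈ U) (m : ℕ) {φ : ℝ → 𝕜}
    (hφ : Continuous φ) {h : (Fin n → 𝕜) → 𝕜} (hh : ContDiffOn 𝕜 ∞ h U) :
    ContDiffOn 𝕜 m (scaledMean i φ h) U := by
  have hdiff : ∀ {φ : ℝ → 𝕜} (_ : Continuous φ) {h : (Fin n → 𝕜) → 𝕜}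
      (_ : ContDiffOn 𝕜 ∞ h U), DifferentiableOn 𝕜 (scaledMean i φ h) U :=
    fun hφ _ hh x hx => (hasFDerivAt_scaledMean i hφ hU hUi (hh.of_le (by simp))
      hx).differentiableAt.differentiableWithinAt
  induction m generalizing φ h with
  | zero => exact contDiffOn_zero.2 (hdiff hφ hh).continuousOn
  | succ m ih =>
    have h1 : ((m + 1 : ℕ) : WithTop ℕ∞) = (m : WithTop ℕ∞) + 1 := by simp
    rw [h1, contDiffOn_succ_iff_fderiv_of_isOpen hU]
    refine ⟨hdiff hφ hh, fun hω => by simp at hω, ?_⟩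
    rw [contDiffOn_clm_apply]
    intro y
    have hd : ∀ y, ContDiffOn 𝕜 ∞ (fun x => fderiv 𝕜 h x y) U := fun y =>
      (hh.fderiv_of_isOpen hU (by simp)).clm_apply contDiffOn_const
    have hof : Continuous fun t : ℝ => (t : 𝕜) := RCLike.continuous_ofReal
    refine ((ih hφ (hd y)).add ((contDiffOn_const (c := y i)).mul
      (ih (φ := fun t => φ t * ((t : 𝕜) - 1)) (hφ.mul (hof.sub continuous_const))
        (hd (Pi.single i 1))))).congr fun x hx => ?_
    exact fderiv_scaledMean_apply i hφ hU hUi (hh.of_le (by simp)) hx y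

lemma contDiffOn_scaledMean_one (r : Regularity) (i : Fin n) {U : Set (Fin n → 𝕜)} (hU : IsOpen U)
    (hUi : ∀ x ∈ U, ∀ t ∈ Icc (0 : ℝ) 1, scaleCoord 𝕜 i t x ∈ U) {h : (Fin n → 𝕜) → 𝕜}
    (hh : ContDiffOn 𝕜 r.order h U) : ContDiffOn 𝕜 r.order (scaledMean i (fun _ => 1) h) U := by
  cases r with
  | smooth =>
    exact contDiffOn_infty.2 fun m => contDiffOn_scaledMean i hU hUi m continuous_const hh
  | analytic =>
    have h1 : AnalyticOnNhd 𝕜 h U := fun x hx =>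
      (hh.contDiffAt (hU.mem_nhds hx)).analyticAt
    intro x hx
    exact (AnalyticAt.contDiffAt
      (analyticAt_scaledMean_one i hU hUi h1 hx)).contDiffWithinAt

/-- The primitive of `h` in the `i`-th coordinate which vanishes for `x_i = 0`. -/
noncomputable def coordPrimitive (i : Fin n) (h : (Fin n → 𝕜) → 𝕜) (x : Fin n → 𝕜) : 𝕜 :=
  x i * scaledMean i (fun _ => 1) h x

lemma fderiv_coordPrimitive_apply (i : Fin n) {h : (Fin n → 𝕜) → 𝕜} {U : Set (Fin n → 𝕜)}
    (hU : IsOpen U) (hUi : ∀ x ∈ U, ∀ t ∈ Icc (0 : ℝ) 1, scaleCoord 𝕜 i t x ∈ U)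
    (hh : ContDiffOn 𝕜 1 h U) {x₀ : Fin n → 𝕜} (hx₀ : x₀ ∈ U) (y : Fin n → 𝕜) :
    fderiv 𝕜 (coordPrimitive i h) x₀ y =
      y i * scaledMean i (fun _ => 1) h x₀ +
        x₀ i * fderiv 𝕜 (scaledMean i (fun _ => 1) h) x₀ y := by
  have h1 := (hasFDerivAt_apply (𝕜 := 𝕜) (F' := fun _ : Fin n => 𝕜) i x₀).mul
    (hasFDerivAt_scaledMean i (φ := fun _ => 1) continuous_const hU hUi hh hx₀)
  have h2 := (hasFDerivAt_scaledMean i (φ := fun _ => 1) continuous_const hU hUi hh hx₀).fderiv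
  rw [← h2] at h1
  have h3 : fderiv 𝕜 (coordPrimitive i h) x₀ = _ := h1.fderiv
  rw [h3]
  simp
  ring

/-- For `j ≠ i` differentiation passes under the integral without extra terms, and its integrand
vanishes on the whole segment. -/
lemma fderiv_coordPrimitive_of_ne {i j : Fin n} (hij : j ≠ i) {h : (Fin n → 𝕜) → 𝕜}
    {U : Set (Fin n → 𝕜)} (hU : IsOpen U)
    (hUi : ∀ x ∈ U, ∀ t ∈ Icc (0 : ℝ) 1, scaleCoord 𝕜 i t x ∈ U) (hh : ContDiffOn 𝕜 1 h U)
    (h0 : ∀ x ∈ U, fderiv 𝕜 h x (Pi.single j 1) = 0) {x₀ : Fin n → 𝕜} (hx₀ : x₀ ∈ U) :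
    fderiv 𝕜 (coordPrimitive i h) x₀ (Pi.single j 1) = 0 := by
  rw [fderiv_coordPrimitive_apply i hU hUi hh hx₀,
    fderiv_scaledMean_apply i continuous_const hU hUi hh hx₀, Pi.single_eq_of_ne hij.symm]
  simp only [zero_mul, zero_add, add_zero, scaledMean]
  rw [intervalIntegral.integral_congr (g := fun _ => 0), intervalIntegral.integral_zero, mul_zero]
  intro t ht
  rw [uIcc_of_le zero_le_one] at ht
  simp [h0 _ (hUi x₀ hx₀ t ht)]

/-- The derivative equals the integral over the unit interval of `d/dt (t · h(…, t x_i, …))`, and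
the fundamental theorem of calculus evaluates it. The parameter `t` is real also when the base field
is complex. -/
lemma fderiv_coordPrimitive_self (i : Fin n) {h : (Fin n → 𝕜) → 𝕜} {U : Set (Fin n → 𝕜)}
    (hU : IsOpen U) (hUi : ∀ x ∈ U, ∀ t ∈ Icc (0 : ℝ) 1, scaleCoord 𝕜 i t x ∈ U)
    (hh : ContDiffOn 𝕜 1 h U) {x₀ : Fin n → 𝕜} (hx₀ : x₀ ∈ U) :
    fderiv 𝕜 (coordPrimitive i h) x₀ (Pi.single i 1) = h x₀ := by
  have hof : Continuous fun t : ℝ => (t : 𝕜) := RCLike.continuous_ofReal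
  have h01 : uIcc (0 : ℝ) 1 = Icc 0 1 := uIcc_of_le zero_le_one
  have hfd : ContinuousOn (fderiv 𝕜 h) U := hh.continuousOn_fderiv_of_isOpen hU le_rfl
  have hmap : ContinuousOn (fun t => scaleCoord 𝕜 i t x₀) (Icc 0 1) :=
    ((continuous_scaleCoord i).clm_apply continuous_const).continuousOn
  have hc : ContinuousOn (fun t => fderiv 𝕜 h (scaleCoord 𝕜 i t x₀) (Pi.single i 1)) (Icc 0 1) :=
    (hfd.comp hmap fun t ht => hUi _ hx₀ t ht).clm_apply continuousOn_const
  have hch : ContinuousOn (fun t => h (scaleCoord 𝕜 i t x₀)) (Icc 0 1) :=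
    hh.continuousOn.comp hmap fun t ht => hUi _ hx₀ t ht
  have hderiv : ∀ t ∈ uIcc (0 : ℝ) 1, HasDerivAt (fun t : ℝ => (t : 𝕜) * h (scaleCoord 𝕜 i t x₀))
      (h (scaleCoord 𝕜 i t x₀) + t * (x₀ i *
        fderiv 𝕜 h (scaleCoord 𝕜 i t x₀) (Pi.single i 1))) t := by
    intro t ht
    rw [h01] at ht
    have hd : HasFDerivAt h (fderiv 𝕜 h (scaleCoord 𝕜 i t x₀)) (scaleCoord 𝕜 i t x₀) :=
      ((hh.differentiableOn one_ne_zero).differentiableAt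
        (hU.mem_nhds (hUi x₀ hx₀ t ht))).hasFDerivAt
    have hid : HasDerivAt (fun t : ℝ => (t : 𝕜)) 1 t := by
      simpa using (RCLike.ofRealCLM (K := 𝕜)).hasDerivAt (x := t)
    have hs : HasDerivAt (fun t : ℝ => scaleCoord 𝕜 i t x₀)
        (x₀ i • (Pi.single i 1 : Fin n → 𝕜)) t := by
      have h1 := (((hid.sub_const 1).mul_const (x₀ i)).smul_const
        (Pi.single i 1 : Fin n → 𝕜)).const_add x₀
      rw [one_mul] at h1
      simpa only [← scaleCoord_apply] using h1
    have h2 := hid.mul ((hd.restrictScalars ℝ).comp_hasDerivAt t hs)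
    rw [one_mul] at h2
    exact h2.congr_deriv (by simp)
  have hint := intervalIntegral.integral_eq_sub_of_hasDerivAt hderiv (by
    refine ContinuousOn.intervalIntegrable ?_
    rw [h01]
    exact hch.add (hof.continuousOn.mul (continuousOn_const.mul hc)))
  have e1 : IntervalIntegrable (fun t => h (scaleCoord 𝕜 i t x₀)) volume 0 1 := by
    refine ContinuousOn.intervalIntegrable ?_
    rwa [h01]
  have e2 : IntervalIntegrable (fun t : ℝ => (t : 𝕜) * (x₀ i *
      fderiv 𝕜 h (scaleCoord 𝕜 i t x₀) (Pi.single i 1))) volume 0 1 := by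
    refine ContinuousOn.intervalIntegrable ?_
    rw [h01]
    exact hof.continuousOn.mul (continuousOn_const.mul hc)
  have e3 : IntervalIntegrable (fun t : ℝ =>
      fderiv 𝕜 h (scaleCoord 𝕜 i t x₀) (Pi.single i 1)) volume 0 1 := by
    refine ContinuousOn.intervalIntegrable ?_
    rwa [h01]
  have e4 : IntervalIntegrable (fun t : ℝ => ((t : 𝕜) - 1) *
      fderiv 𝕜 h (scaleCoord 𝕜 i t x₀) (Pi.single i 1)) volume 0 1 := by
    refine ContinuousOn.intervalIntegrable ?_
    rw [h01]
    exact (hof.sub continuous_const).continuousOn.mul hc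
  rw [fderiv_coordPrimitive_apply i hU hUi hh hx₀,
    fderiv_scaledMean_apply i continuous_const hU hUi hh hx₀]
  rw [intervalIntegral.integral_add e1 e2, scaleCoord_one] at hint
  simp only [Pi.single_eq_same, one_mul, scaledMean]
  rw [← intervalIntegral.integral_add e3 e4, ← intervalIntegral.integral_const_mul]
  have h5 : h x₀ = ((1 : ℝ) : 𝕜) * h x₀ - ((0 : ℝ) : 𝕜) * h (scaleCoord 𝕜 i 0 x₀) := by simp
  rw [h5, ← hint]
  congr 1
  refine intervalIntegral.integral_congr fun t _ => ?_
  ring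

end Primitives

/-! ### Commuting derivatives and primitives for germs and global functions. -/

section Germs

variable {𝕜 : Type*} [RCLike 𝕜] {n : ℕ} {r : Regularity} {S : Set (Fin n → 𝕜)}

lemma germPartial_toGerm (i : Fin n) (f : regularFunctions 𝕜 n r S) :
    germPartial 𝕜 n r S i (toGerm 𝕜 n r S f) = toGerm 𝕜 n r S (partialFun 𝕜 n r S i f) :=
  germPartialFun_toGerm 𝕜 n r S i f

lemma germPartial_comm (i j : Fin n) (a : Germs 𝕜 n r S) :
    germPartial 𝕜 n r S i (germPartial 𝕜 n r S j a) =
      germPartial 𝕜 n r S j (germPartial 𝕜 n r S i a) := by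
  obtain ⟨f, rfl⟩ := toGerm_surjective 𝕜 n r S a
  simp only [germPartial_toGerm]
  rw [toGerm_eq]
  have hf : ∀ᶠ x in 𝓝ˢ S, ContDiffAt 𝕜 r.order (f : (Fin n → 𝕜) → 𝕜) x := f.2
  filter_upwards [hf] with x hx
  have h2 : (2 : WithTop ℕ∞) ≤ r.order := by
    cases r
    · exact WithTop.coe_le_coe.2 le_top
    · exact le_top
  have hd : DifferentiableAt 𝕜 (fderiv 𝕜 (f : (Fin n → 𝕜) → 𝕜)) x :=
    (hx.fderiv_right (m := 1) (by simpa [one_add_one_eq_two] using h2)).differentiableAt one_ne_zero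
  have hs : IsSymmSndFDerivAt 𝕜 (f : (Fin n → 𝕜) → 𝕜) x :=
    hx.isSymmSndFDerivAt (by simpa using h2)
  have h3 : ∀ v w, fderiv 𝕜 (fun y => fderiv 𝕜 (f : (Fin n → 𝕜) → 𝕜) y w) x v =
      fderiv 𝕜 (fderiv 𝕜 (f : (Fin n → 𝕜) → 𝕜)) x v w := fun v w => by
    rw [fderiv_clm_apply hd (differentiableAt_const w)]
    simp
  change fderiv 𝕜 (fun y => fderiv 𝕜 (f : (Fin n → 𝕜) → 𝕜) y (Pi.single j 1)) x
    (Pi.single i 1) = fderiv 𝕜 (fun y => fderiv 𝕜 (f : (Fin n → 𝕜) → 𝕜) y (Pi.single i 1)) x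
    (Pi.single j 1)
  rw [h3, h3, hs.eq]

/-- The origin and the whole space have bases of neighbourhoods stable under scaling of each
coordinate. -/
lemma exists_stable_neighbourhood (hS : S = {0} ∨ S = Set.univ) {p : (Fin n → 𝕜) → Prop}
    (hp : ∀ᶠ x in 𝓝ˢ S, p x) : ∃ U : Set (Fin n → 𝕜), IsOpen U ∧ S ⊆ U ∧ (∀ x ∈ U, p x) ∧
      ∀ (i : Fin n), ∀ x ∈ U, ∀ t ∈ Set.Icc (0 : ℝ) 1, scaleCoord 𝕜 i t x ∈ U := by
  rcases hS with rfl | rfl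
  · rw [nhdsSet_singleton] at hp
    obtain ⟨ε, hε, hp⟩ := Metric.eventually_nhds_iff_ball.1 hp
    refine ⟨Metric.ball 0 ε, Metric.isOpen_ball, by simpa using hε, hp, fun i x hx t ht => ?_⟩
    rw [mem_ball_zero_iff] at hx ⊢
    exact (norm_scaleCoord_apply_le i ht x).trans_lt hx
  · rw [nhdsSet_univ, Filter.eventually_top] at hp
    exact ⟨Set.univ, isOpen_univ, le_rfl, fun x _ => hp x, fun _ _ _ _ _ => Set.mem_univ _⟩

lemma Regularity.one_le_order (r : Regularity) : (1 : WithTop ℕ∞) ≤ r.order := by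
  cases r
  · exact WithTop.coe_le_coe.2 le_top
  · exact le_top

lemma exists_primitive_germ (hS : S = {0} ∨ S = Set.univ) (i : Fin n) (a : Germs 𝕜 n r S) :
    ∃ H, germPartial 𝕜 n r S i H = a ∧
      ∀ j, j ≠ i → germPartial 𝕜 n r S j a = 0 → germPartial 𝕜 n r S j H = 0 := by
  obtain ⟨f, rfl⟩ := toGerm_surjective 𝕜 n r S a
  obtain ⟨U, hU, hSU, hfU, hUi⟩ := exists_stable_neighbourhood hS f.2
  have hf : ContDiffOn 𝕜 r.order (f : (Fin n → 𝕜) → 𝕜) U := fun x hx => (hfU x hx).contDiffWithinAt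
  let H : regularFunctions 𝕜 n r S := ⟨coordPrimitive i f, by
    refine eventually_nhdsSet_iff_exists.2 ⟨U, hU, hSU, fun x hx => ?_⟩
    exact (contDiff_apply 𝕜 𝕜 i).contDiffAt.mul
      ((contDiffOn_scaledMean_one r i hU (hUi i) hf).contDiffAt (hU.mem_nhds hx))⟩
  refine ⟨toGerm 𝕜 n r S H, ?_, fun j hj h0 => ?_⟩
  · rw [germPartial_toGerm, toGerm_eq]
    exact eventually_nhdsSet_iff_exists.2 ⟨U, hU, hSU, fun x hx =>
      fderiv_coordPrimitive_self i hU (hUi i) (hf.of_le r.one_le_order) hx⟩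
  · rw [germPartial_toGerm, ← map_zero (toGerm 𝕜 n r S), toGerm_eq] at h0 ⊢
    -- The derivative of `f` may vanish only on a smaller neighbourhood, so a new stable one is
    -- chosen; the primitive is given by a formula that does not refer to the neighbourhood.
    have hf2 : ∀ᶠ x in 𝓝ˢ S, ContDiffAt 𝕜 r.order (f : (Fin n → 𝕜) → 𝕜) x := f.2
    obtain ⟨V, hV, hSV, h0V, hVi⟩ := exists_stable_neighbourhood hS (hf2.and h0)
    have hfV : ContDiffOn 𝕜 r.order (f : (Fin n → 𝕜) → 𝕜) V :=
      fun x hx => (h0V x hx).1.contDiffWithinAt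
    exact eventually_nhdsSet_iff_exists.2 ⟨V, hV, hSV, fun x hx =>
      fderiv_coordPrimitive_of_ne hj hV (hVi i) (hfV.of_le r.one_le_order)
        (fun y hy => (h0V y hy).2) hx⟩

end Germs

end NambuDeformation

open NambuDeformation in
theorem mainTheorem8 (𝕜 : Type*) [RCLike 𝕜] (n q : ℕ) (hq : 1 ≤ q) (hqn : q ≤ n) :
    -- smooth and analytic case: germs at the origin, and fields defined on all of `𝕜ⁿ`
    (∀ (r : Regularity) (S : Set (Fin n → 𝕜)), S = {0} ∨ S = Set.univ →
      ∀ Ω : DForm (Germs 𝕜 n r S) n, IsVolumeForm Ω →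
        IsNambu (germPartial 𝕜 n r S) Ω q (constantNambu (Germs 𝕜 n r S) hqn) ∧
        trivialDeformations (germPartial 𝕜 n r S) (constantNambu (Germs 𝕜 n r S) hqn) ≤
          infinitesimalDeformations (germPartial 𝕜 n r S) Ω q
            (constantNambu (Germs 𝕜 n r S) hqn) ∧
        Subsingleton (DH (germPartial 𝕜 n r S) Ω q (constantNambu (Germs 𝕜 n r S) hqn))) ∧
    -- formal case
    (∀ Ω : DForm (MvPowerSeries (Fin n) 𝕜) n, IsVolumeForm Ω →
      IsNambu (MvPowerSeries.pderiv 𝕜) Ω q (constantNambu (MvPowerSeries (Fin n) 𝕜) hqn) ∧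
      trivialDeformations (MvPowerSeries.pderiv 𝕜)
          (constantNambu (MvPowerSeries (Fin n) 𝕜) hqn) ≤
        infinitesimalDeformations (MvPowerSeries.pderiv 𝕜) Ω q
          (constantNambu (MvPowerSeries (Fin n) 𝕜) hqn) ∧
      Subsingleton (DH (MvPowerSeries.pderiv 𝕜) Ω q
        (constantNambu (MvPowerSeries (Fin n) 𝕜) hqn))) := by
  refine ⟨fun r S hS Ω hΩ => ?_, fun Ω hΩ => ?_⟩
  · exact constantNambu_rigid hqn hq germPartial_comm (exists_primitive_germ hS) hΩ
  · exact constantNambu_rigid hqn hq pderiv_comm exists_primitive_formal hΩ
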